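/- Let $A_1,A_2$ be unital complex $C^*$-algebras, each equipped with a $\mathbb{Z}_2$-grading, i.e. a $*$-automorphism $\theta_i$ of $A_i$ with $\theta_i^2=\mathrm{id}$. An element $a\in A_i$ is homogeneous of grade $\partial a=\pm1$ if $\theta_i(a)=\pm a$. The Fermi tensor product $A_1\,Ⓕ\,A_2$ is the algebraic tensor product $A_1\odot A_2$ with the product and involution determined, on homogeneous elements, by $$(a_1\otimes a_2)(b_1\otimes b_2)=\epsilon(a_2,b_1)\,a_1b_1\otimes a_2b_2,\qquad (a_1\otimes a_2)^*=\epsilon(a_1,a_2)\,a_1^*\otimes a_2^*,$$ where $\epsilon(a,b)=-1$ if $\partial a=\partial b=-1$ and $\epsilon(a,b)=1$ otherwise. Its grading is $\theta=\theta_1\otimes\theta_2$. A state $\omega$ of $A_i$ is even if $\omega\circ\theta_i=\omega$. For even states $\omega_1,\omega_2$ of $A_1,A_2$, let $\pi_{\omega_1\times\omega_2}$ be the GNS representation of $A_1\,Ⓕ\,A_2$ given by the product state $(\omega_1\times\omega_2)(a_1\otimes a_2)=\omega_1(a_1)\omega_2(a_2)$. The spatial norm is $$\|x\|_{\min}=\sup\{\|\pi_{\omega_1\times\omega_2}(x)\|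 : \omega_i \text{ an even state of } A_i,\ i=1,2\},\qquad x\in A_1\,Ⓕ\,A_2 .$$ A $C^*$-norm $\beta$ on $A_1\,Ⓕ\,A_2$ is called cross if $\beta(a_1\otimes a_2)=\|a_1\|\,\|a_2\|$ for all homogeneous $a_1\in A_1$, $a_2\in A_2$, and compatible if $\theta$ extends to a $*$-automorphism of the completion of $A_1\,Ⓕ\,A_2$ with respect to $\beta$. If $A_1$ or $A_2$ is commutative, then every compatible $C^*$-cross norm $\beta$ on $A_1\,Ⓕ\,A_2$ coincides with the spatial norm: $\beta(x)=\|x\|_{\min}$ for every $x\in A_1\,Ⓕ\,A_2$. -/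

import Mathlib

open scoped TensorProduct ComplexOrder InnerProductSpace
open UniformSpace

noncomputable section

/-! ### Positive functionals on unital complex `*`-algebras and the GNS construction -/

section GNS

/-- A positive linear functional on a unital complex `*`-algebra. -/
structure PositiveFunctional (F : Type*) [Ring F] [StarRing F] [Algebra ℂ F] extends
    F →ₗ[ℂ] ℂ where
  nonneg' : ∀ x : F, 0 ≤ toFun (star x * x)

namespace PositiveFunctional

variable {F : Type*} [Ring F] [StarRing F] [Algebra ℂ F]

theorem nonneg (φ : PositiveFunctional F) (x : F) : 0 ≤ φ.toLinearMap (star x * x) :=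
  φ.nonneg' x

variable [StarModule ℂ F]

theorem apply_star (φ : PositiveFunctional F) (x : F) :
    φ.toLinearMap (star x) = star (φ.toLinearMap x) := by
  have h1 := (Complex.nonneg_iff.1 (φ.nonneg (x + 1))).2
  have h2 := (Complex.nonneg_iff.1 (φ.nonneg (x + Complex.I • 1))).2
  have h3 := (Complex.nonneg_iff.1 (φ.nonneg x)).2
  have h4 := (Complex.nonneg_iff.1 (φ.nonneg 1)).2
  simp only [star_add, star_smul, star_one, add_mul, mul_add, mul_one, one_mul, smul_mul_assoc,
    mul_smul_comm, map_add, map_smul, smul_eq_mul, Complex.add_im, Complex.mul_im, Complex.mul_re,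
    Complex.star_def, Complex.conj_I, Complex.neg_im, Complex.neg_re, Complex.I_re,
    Complex.I_im] at h1 h2 h3 h4
  apply Complex.ext <;> simp only [Complex.star_def, Complex.conj_re, Complex.conj_im] <;> linarith

/-- The algebra `F`, regarded as a space with the semi-inner product `⟪x, y⟫ = φ (x* y)`. -/
def PreGNS (_φ : PositiveFunctional F) := F

variable (φ : PositiveFunctional F)

instance : AddCommGroup φ.PreGNS := inferInstanceAs (AddCommGroup F)
instance : Module ℂ φ.PreGNS := inferInstanceAs (Module ℂ F)

/-- The identity map from the algebra to the pre-GNS space. -/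
def toPre : F ≃ₗ[ℂ] φ.PreGNS := LinearEquiv.refl ℂ _

abbrev preCore : PreInnerProductSpace.Core ℂ φ.PreGNS where
  inner x y := φ.toLinearMap (star (φ.toPre.symm x) * φ.toPre.symm y)
  conj_inner_symm x y := by
    rw [← Complex.star_def, ← φ.apply_star, star_mul, star_star]
  re_inner_nonneg x := (Complex.nonneg_iff.1 (φ.nonneg (φ.toPre.symm x))).1
  add_left x y z := by rw [map_add, star_add, add_mul, map_add]
  smul_left x y c := by simp

instance : SeminormedAddCommGroup φ.PreGNS :=
  InnerProductSpace.Core.toSeminormedAddCommGroup (c := φ.preCore)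
instance : InnerProductSpace ℂ φ.PreGNS := InnerProductSpace.ofCore φ.preCore

theorem inner_toPre (x y : F) :
    ⟪φ.toPre x, φ.toPre y⟫_ℂ = φ.toLinearMap (star x * y) := rfl

theorem norm_toPre_sq (x : F) : ‖φ.toPre x‖ ^ 2 = (φ.toLinearMap (star x * x)).re := by
  rw [← inner_toPre, ← inner_self_eq_norm_sq (𝕜 := ℂ)]; rfl

/-- The GNS Hilbert space: the Hausdorff completion of `F` for `⟪x, y⟫ = φ (x* y)`. -/
abbrev GNS := Completion φ.PreGNS

/-- Left multiplication by `x` is bounded on the pre-GNS space. -/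
def LeftBounded (x : F) : Prop := ∃ C : ℝ, ∀ y : F, ‖φ.toPre (x * y)‖ ≤ C * ‖φ.toPre y‖

variable {φ}

theorem LeftBounded.add {x y : F} (hx : φ.LeftBounded x) (hy : φ.LeftBounded y) :
    φ.LeftBounded (x + y) := by
  obtain ⟨C, hC⟩ := hx
  obtain ⟨D, hD⟩ := hy
  refine ⟨C + D, fun z => ?_⟩
  rw [add_mul, map_add, add_mul]
  exact (norm_add_le _ _).trans (add_le_add (hC z) (hD z))

theorem LeftBounded.mul {x y : F} (hx : φ.LeftBounded x) (hy : φ.LeftBounded y) :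
    φ.LeftBounded (x * y) := by
  obtain ⟨C, hC⟩ := hx
  obtain ⟨D, hD⟩ := hy
  refine ⟨|C| * D, fun z => ?_⟩
  rw [mul_assoc, mul_assoc]
  refine (hC _).trans ((mul_le_mul_of_nonneg_right (le_abs_self C) (norm_nonneg _)).trans ?_)
  exact mul_le_mul_of_nonneg_left (hD z) (abs_nonneg C)

theorem leftBounded_of_starAlgHom {A : Type*} [CStarAlgebra A] (j : A →⋆ₐ[ℂ] F) (a : A) :
    φ.LeftBounded (j a) := by
  let _ := CStarAlgebra.spectralOrder A
  let _ := CStarAlgebra.spectralOrderedRing A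
  have h : star a * a ≤ algebraMap ℝ A ‖star a * a‖ :=
    IsSelfAdjoint.le_algebraMap_norm_self (IsSelfAdjoint.star_mul_self a)
  obtain ⟨c, hc⟩ := CStarAlgebra.nonneg_iff_eq_star_mul_self.1 (sub_nonneg.2 h)
  refine ⟨‖a‖, fun y => ?_⟩
  rw [← abs_of_nonneg (norm_nonneg a), ← abs_of_nonneg (norm_nonneg (φ.toPre y)), ← abs_mul,
    ← abs_of_nonneg (norm_nonneg (φ.toPre (j a * y))), ← sq_le_sq, mul_pow, norm_toPre_sq,
    norm_toPre_sq]
  have h1 := (Complex.nonneg_iff.1 (φ.nonneg (j c * y))).1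
  have h2 : star (j c * y) * (j c * y) =
      ((‖a‖ ^ 2 : ℝ) : ℂ) • (star y * y) - star (j a * y) * (j a * y) := by
    have h3 : j (star c * c) = ((‖a‖ ^ 2 : ℝ) : ℂ) • 1 - j (star a * a) := by
      rw [← hc, map_sub, CStarRing.norm_star_mul_self, ← sq,
        IsScalarTower.algebraMap_apply ℝ ℂ A, AlgHomClass.commutes j,
        Algebra.algebraMap_eq_smul_one]
      rfl
    rw [map_mul, map_mul, map_star, map_star] at h3
    calc star (j c * y) * (j c * y) = star y * (star (j c) * j c) * y := by
          rw [star_mul]; noncomm_ring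
      _ = _ := by
          rw [h3, star_mul, mul_sub, sub_mul, mul_smul_comm, mul_one, smul_mul_assoc]
          noncomm_ring
  rw [h2, map_sub, map_smul, smul_eq_mul, Complex.sub_re, Complex.re_ofReal_mul] at h1
  linarith

variable (φ)

/-- Left multiplication as a bounded operator on the pre-GNS space. -/
def leftMul (hφ : ∀ x, φ.LeftBounded x) (x : F) : φ.PreGNS →L[ℂ] φ.PreGNS :=
  (φ.toPre.toLinearMap ∘ₗ LinearMap.mulLeft ℂ x ∘ₗ
    φ.toPre.symm.toLinearMap).mkContinuousOfExistsBound (hφ x)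

@[simp]
theorem leftMul_toPre (hφ : ∀ x, φ.LeftBounded x) (x y : F) :
    φ.leftMul hφ x (φ.toPre y) = φ.toPre (x * y) := rfl

theorem gns_ext {S T : φ.GNS →L[ℂ] φ.GNS}
    (h : ∀ y : F, S (φ.toPre y : φ.GNS) = T (φ.toPre y : φ.GNS)) : S = T := by
  ext z
  induction z using Completion.induction_on with
  | hp => exact isClosed_eq S.continuous T.continuous
  | ih z => exact h z

/-- The GNS representation: `π(x)` is the extension to the GNS space of `y ↦ x y`. -/
def gnsRep (hφ : ∀ x, φ.LeftBounded x) : F →⋆ₐ[ℂ] (φ.GNS →L[ℂ] φ.GNS) where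
  toFun x := (φ.leftMul hφ x).completion
  map_one' := φ.gns_ext fun y => by simp
  map_mul' a b := φ.gns_ext fun y => by simp [mul_assoc]
  map_zero' := φ.gns_ext fun y => by
    simp only [ContinuousLinearMap.completion_apply_coe, leftMul_toPre, zero_mul, map_zero]
    exact Completion.coe_zero
  map_add' a b := φ.gns_ext fun y => by simp [add_mul, Completion.coe_add]
  commutes' r := φ.gns_ext fun y => by
    simp [Algebra.algebraMap_eq_smul_one]
  map_star' a := by
    refine (ContinuousLinearMap.eq_adjoint_iff _ _).mpr fun x y => ?_
    induction x, y using Completion.induction_on₂ with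
    | hp => apply isClosed_eq <;> fun_prop
    | ih x y =>
      obtain ⟨x, rfl⟩ := φ.toPre.surjective x
      obtain ⟨y, rfl⟩ := φ.toPre.surjective y
      simp [inner_toPre, mul_assoc]

end PositiveFunctional

end GNS

/-! ### `C*`-norms on a `*`-algebra and their completions -/

section CStarNorm

/-- A `C*`-norm on a unital complex `*`-algebra. -/
structure CStarNorm (F : Type*) [Ring F] [StarRing F] [Algebra ℂ F] extends Seminorm ℂ F where
  eq_zero' : ∀ x, toFun x = 0 → x = 0
  mul_le' : ∀ x y, toFun (x * y) ≤ toFun x * toFun y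
  star_mul_self' : ∀ x, toFun (star x * x) = toFun x * toFun x

namespace CStarNorm

variable {F : Type*} [Ring F] [StarRing F] [Algebra ℂ F]

instance : CoeFun (CStarNorm F) (fun _ => F → ℝ) := ⟨fun β => β.toSeminorm⟩

theorem mul_le (β : CStarNorm F) (x y : F) : β (x * y) ≤ β x * β y := β.mul_le' x y
theorem star_mul_self (β : CStarNorm F) (x : F) : β (star x * x) = β x * β x :=
  β.star_mul_self' x

variable [StarModule ℂ F]

/-- The `*`-algebra `F` equipped with the norm `β`. -/
def Carrier (_β : CStarNorm F) := F

variable (β : CStarNorm F)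

instance : Ring β.Carrier := inferInstanceAs (Ring F)
instance : StarRing β.Carrier := inferInstanceAs (StarRing F)
instance : Algebra ℂ β.Carrier := inferInstanceAs (Algebra ℂ F)
instance : StarModule ℂ β.Carrier := inferInstanceAs (StarModule ℂ F)

/-- The identity map from `F` to `F` normed by `β`. -/
def toCarrier : F ≃⋆ₐ[ℂ] β.Carrier := StarAlgEquiv.refl ℂ F

instance : NormedRing β.Carrier :=
  { (inferInstance : Ring β.Carrier),
    (AddGroupNorm.toNormedAddCommGroup
      { toFun := β.toSeminorm
        map_zero' := map_zero β.toSeminorm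
        add_le' := map_add_le_add β.toSeminorm
        neg' := map_neg_eq_map β.toSeminorm
        eq_zero_of_map_eq_zero' := β.eq_zero' } : NormedAddCommGroup β.Carrier) with
    norm_mul_le := β.mul_le }

theorem norm_toCarrier (x : F) : ‖β.toCarrier x‖ = β x := rfl

instance : NormedAlgebra ℂ β.Carrier where
  norm_smul_le r x := (map_smul_eq_mul β.toSeminorm r x).le

instance : CStarRing β.Carrier where
  norm_mul_self_le x := (β.star_mul_self x).ge

/-- The completion of `F` with respect to the norm `β`. -/
abbrev Completion := UniformSpace.Completion β.Carrier

/-- The canonical map of `F` into its completion. -/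
def toCompletion (x : F) : β.Completion := (β.toCarrier x : UniformSpace.Completion β.Carrier)

/-- The involution of the completion is the continuous extension of the involution of `F`. -/
instance : Star β.Completion := ⟨UniformSpace.Completion.map star⟩

theorem continuous_star_completion : Continuous (star : β.Completion → β.Completion) :=
  UniformSpace.Completion.continuous_map

theorem coe_star (x : β.Carrier) : ((star x : β.Carrier) : β.Completion) = star (x : β.Completion) :=
  (UniformSpace.Completion.map_coe (starₗᵢ ℂ (E := β.Carrier)).isometry.uniformContinuous x).symm

theorem star_smul_completion (c : ℂ) (x : β.Completion) : star (c • x) = star c • star x := by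
  induction x using UniformSpace.Completion.induction_on with
  | hp =>
    exact isClosed_eq (β.continuous_star_completion.comp (continuous_const_smul c))
      (β.continuous_star_completion.const_smul (star c))
  | ih x =>
    rw [← UniformSpace.Completion.coe_smul, ← coe_star, ← coe_star,
      ← UniformSpace.Completion.coe_smul, star_smul]

instance : ContinuousStar β.Completion := ⟨β.continuous_star_completion⟩

/-- The completion is a `C*`-algebra. -/
instance : CStarAlgebra β.Completion :=
  { (inferInstance : NormedRing β.Completion),
    (inferInstance : Algebra ℂ β.Completion),
    (inferInstance : NormedSpace ℂ β.Completion) with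
    star_involutive := fun x => by
      induction x using UniformSpace.Completion.induction_on with
      | hp => exact isClosed_eq (by fun_prop) (by fun_prop)
      | ih x => rw [← coe_star, ← coe_star, star_star]
    star_mul := fun x y => by
      induction x, y using UniformSpace.Completion.induction_on₂ with
      | hp => exact isClosed_eq (by fun_prop) (by fun_prop)
      | ih x y =>
        rw [← UniformSpace.Completion.coe_mul, ← coe_star, ← coe_star, ← coe_star,
          ← UniformSpace.Completion.coe_mul, star_mul]
    star_add := fun x y => by
      induction x, y using UniformSpace.Completion.induction_on₂ with
      | hp => exact isClosed_eq (by fun_prop) (by fun_prop)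
      | ih x y =>
        rw [← UniformSpace.Completion.coe_add, ← coe_star, ← coe_star, ← coe_star,
          ← UniformSpace.Completion.coe_add, star_add]
    complete := CompleteSpace.complete
    norm_mul_self_le := fun x => by
      induction x using UniformSpace.Completion.induction_on with
      | hp => exact isClosed_le (by fun_prop) (by fun_prop)
      | ih x =>
        rw [← coe_star, ← UniformSpace.Completion.coe_mul, UniformSpace.Completion.norm_coe,
          UniformSpace.Completion.norm_coe]
        exact CStarRing.norm_mul_self_le x
    star_smul := β.star_smul_completion }

end CStarNorm

end CStarNorm

/-! ### `ℤ₂`-graded `C*`-algebras and their Fermi tensor product -/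

/-- A `ℤ₂`-grading of a `C*`-algebra: an involutive `*`-automorphism. -/
structure Grading (A : Type*) [CStarAlgebra A] where
  auto : A ≃⋆ₐ[ℂ] A
  involutive : ∀ a, auto (auto a) = a

namespace Grading

variable {A : Type*} [CStarAlgebra A] (θ : Grading A)

/-- The grading automorphism as a linear map. -/
def lin : A →ₗ[ℂ] A := (θ.auto : A ≃⋆ₐ[ℂ] A).toAlgEquiv.toLinearMap

@[simp] theorem lin_apply (a : A) : θ.lin a = θ.auto a := rfl

/-- The projection `(id + i θ) / 2` onto the homogeneous component of grade `i ∈ {1, -1}`. -/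
def proj (i : ℤˣ) : A →ₗ[ℂ] A := (2⁻¹ : ℂ) • (LinearMap.id + ((i : ℤ) : ℂ) • θ.lin)

/-- `a` is homogeneous: even (`θ a = a`) or odd (`θ a = -a`). -/
def IsHomogeneous (a : A) : Prop := θ.auto a = a ∨ θ.auto a = -a

theorem proj_apply (i : ℤˣ) (a : A) :
    θ.proj i a = (2⁻¹ : ℂ) • (a + ((i : ℤ) : ℂ) • θ.auto a) := rfl

theorem auto_smul (c : ℂ) (a : A) : θ.auto (c • a) = c • θ.auto a := map_smul θ.auto c a

theorem proj_add_proj (a : A) : θ.proj 1 a + θ.proj (-1) a = a := by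
  simp only [proj_apply, Units.val_one, Units.val_neg, Int.cast_one, Int.cast_neg]
  module

theorem proj_sub_proj (a : A) : θ.proj 1 a - θ.proj (-1) a = θ.auto a := by
  simp only [proj_apply, Units.val_one, Units.val_neg, Int.cast_one, Int.cast_neg]
  module

theorem auto_proj_one (a : A) : θ.auto (θ.proj 1 a) = θ.proj 1 a := by
  simp only [proj_apply, Units.val_one, Int.cast_one, auto_smul, map_add, θ.involutive]
  module

theorem auto_proj_neg_one (a : A) : θ.auto (θ.proj (-1) a) = -θ.proj (-1) a := by
  simp only [proj_apply, Units.val_one, Units.val_neg, Int.cast_one, Int.cast_neg, auto_smul,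
    map_add, θ.involutive]
  module

theorem proj_of_even {a : A} (h : θ.auto a = a) : θ.proj 1 a = a ∧ θ.proj (-1) a = 0 := by
  simp only [proj_apply, Units.val_one, Units.val_neg, Int.cast_one, Int.cast_neg, h]
  constructor <;> module

theorem proj_of_odd {a : A} (h : θ.auto a = -a) : θ.proj 1 a = 0 ∧ θ.proj (-1) a = a := by
  simp only [proj_apply, Units.val_one, Units.val_neg, Int.cast_one, Int.cast_neg, h]
  constructor <;> module

theorem proj_one_mul (i : ℤˣ) (a b : A) : θ.proj i (θ.proj 1 a * b) = θ.proj 1 a * θ.proj i b := by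
  rw [θ.proj_apply i, map_mul, auto_proj_one, θ.proj_apply i, mul_smul_comm, mul_add,
    mul_smul_comm]

theorem proj_neg_one_mul (i : ℤˣ) (a b : A) :
    θ.proj i (θ.proj (-1) a * b) = θ.proj (-1) a * θ.proj (-i) b := by
  rw [θ.proj_apply i, map_mul, auto_proj_neg_one, θ.proj_apply (-i), mul_smul_comm, mul_add,
    mul_smul_comm, Units.val_neg, Int.cast_neg, neg_mul, smul_neg, neg_smul]

theorem proj_star (i : ℤˣ) (a : A) : θ.proj i (star a) = star (θ.proj i a) := by
  rw [proj_apply, proj_apply, star_smul, star_add, star_smul, map_star]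
  simp

end Grading

/-- The sign `ε(i, j)`: it is `-1` if `i = j = -1` and `1` otherwise. -/
def fermiSign (i j : ℤˣ) : ℂ := if i = -1 ∧ j = -1 then -1 else 1

section Fermi

variable {A₁ A₂ : Type*} [CStarAlgebra A₁] [CStarAlgebra A₂]

/-- The component `x_{i,j}` of `x` in the tensor product of the homogeneous parts of grades `i`
and `j`. -/
def fermiComp (θ₁ : Grading A₁) (θ₂ : Grading A₂) (i j : ℤˣ) : A₁ ⊗[ℂ] A₂ →ₗ[ℂ] A₁ ⊗[ℂ] A₂ :=
  TensorProduct.map (θ₁.proj i) (θ₂.proj j)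

/-- The Fermi product `x y = ∑ ε(j, k) x_{i,j} y_{k,l}`, in terms of the usual product of the
algebraic tensor product. -/
def fermiMul (θ₁ : Grading A₁) (θ₂ : Grading A₂) :
    A₁ ⊗[ℂ] A₂ →ₗ[ℂ] A₁ ⊗[ℂ] A₂ →ₗ[ℂ] A₁ ⊗[ℂ] A₂ :=
  ∑ i : ℤˣ, ∑ j : ℤˣ, ∑ k : ℤˣ, ∑ l : ℤˣ, fermiSign j k •
    (LinearMap.mul ℂ (A₁ ⊗[ℂ] A₂)).compl₁₂ (fermiComp θ₁ θ₂ i j) (fermiComp θ₁ θ₂ k l)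

/-- The Fermi involution `x* = ∑ ε(i, j) x_{i,j}*`, in terms of the usual involution of the
algebraic tensor product. -/
def fermiStar (θ₁ : Grading A₁) (θ₂ : Grading A₂) (x : A₁ ⊗[ℂ] A₂) : A₁ ⊗[ℂ] A₂ :=
  ∑ i : ℤˣ, ∑ j : ℤˣ, fermiSign i j • star (fermiComp θ₁ θ₂ i j x)

theorem fermiMul_tmul (θ₁ : Grading A₁) (θ₂ : Grading A₂) (a c : A₁) (b d : A₂) :
    fermiMul θ₁ θ₂ (a ⊗ₜ b) (c ⊗ₜ d) =
      (a * c) ⊗ₜ (θ₂.proj 1 b * d) + (a * θ₁.auto c) ⊗ₜ (θ₂.proj (-1) b * d) := by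
  have h : (1 : ℤˣ) ≠ -1 := by decide
  conv_rhs => rw [← θ₁.proj_sub_proj c, ← θ₁.proj_add_proj a, ← θ₂.proj_add_proj d]
  conv_rhs => enter [1]; rw [← θ₁.proj_add_proj c]
  simp only [fermiMul, fermiSign, fermiComp, UnitsInt.univ, Finset.sum_pair h,
    LinearMap.add_apply, LinearMap.smul_apply, LinearMap.compl₁₂_apply, TensorProduct.map_tmul,
    LinearMap.mul_apply', Algebra.TensorProduct.tmul_mul_tmul, h, and_true,
    and_false, if_true, if_false, mul_add, add_mul, mul_sub, TensorProduct.add_tmul,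
    TensorProduct.tmul_add, TensorProduct.sub_tmul]
  module

theorem fermiStar_tmul (θ₁ : Grading A₁) (θ₂ : Grading A₂) (a : A₁) (b : A₂) :
    fermiStar θ₁ θ₂ (a ⊗ₜ b) =
      star a ⊗ₜ star (θ₂.proj 1 b) + star (θ₁.auto a) ⊗ₜ star (θ₂.proj (-1) b) := by
  have h : (1 : ℤˣ) ≠ -1 := by decide
  conv_rhs => rw [← θ₁.proj_sub_proj a]
  conv_rhs => enter [1]; rw [← θ₁.proj_add_proj a]
  simp only [fermiStar, fermiSign, fermiComp, UnitsInt.univ, Finset.sum_pair h,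
    TensorProduct.map_tmul, TensorProduct.star_tmul, h, and_true,
    and_false, if_true, if_false, star_add, star_sub, TensorProduct.add_tmul,
    TensorProduct.sub_tmul]
  module

theorem fermiStar_add (θ₁ : Grading A₁) (θ₂ : Grading A₂) (x y : A₁ ⊗[ℂ] A₂) :
    fermiStar θ₁ θ₂ (x + y) = fermiStar θ₁ θ₂ x + fermiStar θ₁ θ₂ y := by
  simp [fermiStar, Finset.sum_add_distrib]

theorem fermiMul_assoc (θ₁ : Grading A₁) (θ₂ : Grading A₂) (x y z : A₁ ⊗[ℂ] A₂) :
    fermiMul θ₁ θ₂ (fermiMul θ₁ θ₂ x y) z = fermiMul θ₁ θ₂ x (fermiMul θ₁ θ₂ y z) := by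
  induction x using TensorProduct.induction_on with
  | zero => simp
  | add x₁ x₂ h₁ h₂ => simp only [map_add, LinearMap.add_apply, h₁, h₂]
  | tmul a b =>
    induction y using TensorProduct.induction_on with
    | zero => simp
    | add x₁ x₂ h₁ h₂ => simp only [map_add, LinearMap.add_apply, h₁, h₂]
    | tmul c d =>
      induction z using TensorProduct.induction_on with
      | zero => simp
      | add x₁ x₂ h₁ h₂ => simp only [map_add, h₁, h₂]
      | tmul e f =>
        simp only [fermiMul_tmul, map_add, LinearMap.add_apply, Grading.proj_one_mul,
          Grading.proj_neg_one_mul, map_mul, θ₁.involutive, neg_neg, mul_assoc]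
        abel

theorem fermiStar_star (θ₁ : Grading A₁) (θ₂ : Grading A₂) (x : A₁ ⊗[ℂ] A₂) :
    fermiStar θ₁ θ₂ (fermiStar θ₁ θ₂ x) = x := by
  induction x using TensorProduct.induction_on with
  | zero => simp [fermiStar]
  | add x₁ x₂ h₁ h₂ => simp only [fermiStar_add, h₁, h₂]
  | tmul a b =>
    have e := θ₂.proj_of_even (θ₂.auto_proj_one b)
    have o := θ₂.proj_of_odd (θ₂.auto_proj_neg_one b)
    simp only [fermiStar_tmul, fermiStar_add, Grading.proj_star, e.1, e.2, o.1, o.2, star_star,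
      star_zero, TensorProduct.tmul_zero, map_star, θ₁.involutive, add_zero, zero_add]
    rw [← TensorProduct.tmul_add, θ₂.proj_add_proj]

theorem fermiStar_mul (θ₁ : Grading A₁) (θ₂ : Grading A₂) (x y : A₁ ⊗[ℂ] A₂) :
    fermiStar θ₁ θ₂ (fermiMul θ₁ θ₂ x y) =
      fermiMul θ₁ θ₂ (fermiStar θ₁ θ₂ y) (fermiStar θ₁ θ₂ x) := by
  induction x using TensorProduct.induction_on with
  | zero => simp [fermiStar]
  | add x₁ x₂ h₁ h₂ => simp only [map_add, LinearMap.add_apply, fermiStar_add, h₁, h₂]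
  | tmul a b =>
    induction y using TensorProduct.induction_on with
    | zero => simp [fermiStar]
    | add x₁ x₂ h₁ h₂ => simp only [map_add, LinearMap.add_apply, fermiStar_add, h₁, h₂]
    | tmul c d =>
      have e := θ₂.proj_of_even (θ₂.auto_proj_one d)
      have o := θ₂.proj_of_odd (θ₂.auto_proj_neg_one d)
      simp only [fermiMul_tmul, fermiStar_tmul, fermiStar_add, map_add, LinearMap.add_apply,
        Grading.proj_one_mul, Grading.proj_neg_one_mul, Grading.proj_star, e.1, e.2, o.1, o.2,
        star_mul, map_mul, map_star, star_zero, zero_mul, TensorProduct.tmul_zero,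
        θ₁.involutive, neg_neg, add_zero, zero_add]
      abel

/-- The algebraic Fermi tensor product `A₁ Ⓕ A₂`: as a linear space it is `A₁ ⊗ A₂`, with the
product `fermiMul` and the involution `fermiStar`. -/
def FermiTensor (_θ₁ : Grading A₁) (_θ₂ : Grading A₂) := A₁ ⊗[ℂ] A₂

namespace FermiTensor

variable {θ₁ : Grading A₁} {θ₂ : Grading A₂}

instance : AddCommGroup (FermiTensor θ₁ θ₂) := inferInstanceAs (AddCommGroup (A₁ ⊗[ℂ] A₂))
instance : Module ℂ (FermiTensor θ₁ θ₂) := inferInstanceAs (Module ℂ (A₁ ⊗[ℂ] A₂))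

/-- The identification of the underlying linear spaces. -/
def ofTensor (θ₁ : Grading A₁) (θ₂ : Grading A₂) : A₁ ⊗[ℂ] A₂ ≃ₗ[ℂ] FermiTensor θ₁ θ₂ :=
  LinearEquiv.refl ℂ _

/-- The elementary tensor `a Ⓕ b`. -/
def tmul (θ₁ : Grading A₁) (θ₂ : Grading A₂) (a : A₁) (b : A₂) : FermiTensor θ₁ θ₂ :=
  ofTensor θ₁ θ₂ (a ⊗ₜ b)

instance : Mul (FermiTensor θ₁ θ₂) where
  mul x y := ofTensor θ₁ θ₂ (fermiMul θ₁ θ₂ ((ofTensor θ₁ θ₂).symm x) ((ofTensor θ₁ θ₂).symm y))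

instance : One (FermiTensor θ₁ θ₂) where
  one := tmul θ₁ θ₂ 1 1

theorem mul_def (x y : FermiTensor θ₁ θ₂) :
    x * y = ofTensor θ₁ θ₂
      (fermiMul θ₁ θ₂ ((ofTensor θ₁ θ₂).symm x) ((ofTensor θ₁ θ₂).symm y)) := rfl

theorem one_def : (1 : FermiTensor θ₁ θ₂) = tmul θ₁ θ₂ 1 1 := rfl

theorem induction_on {p : FermiTensor θ₁ θ₂ → Prop} (x : FermiTensor θ₁ θ₂) (zero : p 0)
    (tmul : ∀ a b, p (tmul θ₁ θ₂ a b)) (add : ∀ x y, p x → p y → p (x + y)) : p x :=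
  TensorProduct.induction_on (motive := fun y : A₁ ⊗[ℂ] A₂ => p (ofTensor θ₁ θ₂ y)) x zero tmul add

theorem tmul_mul_tmul (a c : A₁) (b d : A₂) :
    tmul θ₁ θ₂ a b * tmul θ₁ θ₂ c d =
      tmul θ₁ θ₂ (a * c) (θ₂.proj 1 b * d) + tmul θ₁ θ₂ (a * θ₁.auto c) (θ₂.proj (-1) b * d) :=
  fermiMul_tmul θ₁ θ₂ a c b d

theorem tmul_zero (a : A₁) : tmul θ₁ θ₂ a 0 = 0 := TensorProduct.tmul_zero _ a

theorem tmul_add (a : A₁) (b c : A₂) :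
    tmul θ₁ θ₂ a (b + c) = tmul θ₁ θ₂ a b + tmul θ₁ θ₂ a c := TensorProduct.tmul_add a b c

theorem fermi_add_mul (x y z : FermiTensor θ₁ θ₂) : (x + y) * z = x * z + y * z := by
  simp only [mul_def, map_add, LinearMap.add_apply]

theorem fermi_mul_add (x y z : FermiTensor θ₁ θ₂) : x * (y + z) = x * y + x * z := by
  simp only [mul_def, map_add]

theorem fermi_zero_mul (x : FermiTensor θ₁ θ₂) : 0 * x = 0 := by
  simp only [mul_def, map_zero, LinearMap.zero_apply]

theorem fermi_mul_zero (x : FermiTensor θ₁ θ₂) : x * 0 = 0 := by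
  simp only [mul_def, map_zero]

theorem fermi_mul_assoc (x y z : FermiTensor θ₁ θ₂) : x * y * z = x * (y * z) := by
  simp only [mul_def, LinearEquiv.symm_apply_apply, fermiMul_assoc]

theorem fermi_one_mul (x : FermiTensor θ₁ θ₂) : 1 * x = x := by
  have h := θ₂.proj_of_even (map_one θ₂.auto)
  induction x using FermiTensor.induction_on with
  | zero => exact fermi_mul_zero _
  | tmul a b =>
    rw [one_def, tmul_mul_tmul, h.1, h.2, one_mul, zero_mul, one_mul, tmul_zero, add_zero]
  | add x y hx hy => rw [fermi_mul_add, hx, hy]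

theorem fermi_mul_one (x : FermiTensor θ₁ θ₂) : x * 1 = x := by
  induction x using FermiTensor.induction_on with
  | zero => exact fermi_zero_mul _
  | tmul a b =>
    rw [one_def, tmul_mul_tmul, map_one, mul_one, mul_one, mul_one, ← tmul_add,
      θ₂.proj_add_proj]
  | add x y hx hy => rw [fermi_add_mul, hx, hy]

instance : Ring (FermiTensor θ₁ θ₂) :=
  { (inferInstance : AddCommGroup (FermiTensor θ₁ θ₂)) with
    left_distrib := fermi_mul_add
    right_distrib := fermi_add_mul
    zero_mul := fermi_zero_mul
    mul_zero := fermi_mul_zero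
    mul_assoc := fermi_mul_assoc
    one_mul := fermi_one_mul
    mul_one := fermi_mul_one }

instance : Algebra ℂ (FermiTensor θ₁ θ₂) :=
  Algebra.ofModule
    (fun r x y => by simp only [mul_def, map_smul, LinearMap.smul_apply])
    (fun r x y => by simp only [mul_def, map_smul])

instance : StarRing (FermiTensor θ₁ θ₂) where
  star x := ofTensor θ₁ θ₂ (fermiStar θ₁ θ₂ ((ofTensor θ₁ θ₂).symm x))
  star_involutive x := fermiStar_star θ₁ θ₂ x
  star_mul x y := fermiStar_mul θ₁ θ₂ x y
  star_add x y := fermiStar_add θ₁ θ₂ x y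

theorem star_tmul (a : A₁) (b : A₂) :
    star (tmul θ₁ θ₂ a b) =
      tmul θ₁ θ₂ (star a) (star (θ₂.proj 1 b)) +
        tmul θ₁ θ₂ (star (θ₁.auto a)) (star (θ₂.proj (-1) b)) :=
  fermiStar_tmul θ₁ θ₂ a b

theorem fermiStar_smul (c : ℂ) (x : A₁ ⊗[ℂ] A₂) :
    fermiStar θ₁ θ₂ (c • x) = star c • fermiStar θ₁ θ₂ x := by
  simp only [fermiStar, map_smul, star_smul, Finset.smul_sum, smul_comm (star c)]

instance : StarModule ℂ (FermiTensor θ₁ θ₂) where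
  star_smul c x := fermiStar_smul c x

/-- The grading `θ₁ Ⓕ θ₂` of the Fermi tensor product, `a Ⓕ b ↦ θ₁ a Ⓕ θ₂ b`. -/
def grading (θ₁ : Grading A₁) (θ₂ : Grading A₂) : FermiTensor θ₁ θ₂ →ₗ[ℂ] FermiTensor θ₁ θ₂ :=
  (ofTensor θ₁ θ₂).toLinearMap ∘ₗ TensorProduct.map θ₁.lin θ₂.lin ∘ₗ
    (ofTensor θ₁ θ₂).symm.toLinearMap

/-- The embedding `a ↦ a Ⓕ 1`. -/
def inl (θ₁ : Grading A₁) (θ₂ : Grading A₂) : A₁ →⋆ₐ[ℂ] FermiTensor θ₁ θ₂ where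
  toFun a := tmul θ₁ θ₂ a 1
  map_one' := rfl
  map_zero' := TensorProduct.zero_tmul _ _
  map_add' a b := TensorProduct.add_tmul a b 1
  map_mul' a b := by
    have h := θ₂.proj_of_even (map_one θ₂.auto)
    rw [tmul_mul_tmul, h.1, h.2, one_mul, zero_mul, tmul_zero, add_zero]
  commutes' r := by
    rw [Algebra.algebraMap_eq_smul_one, Algebra.algebraMap_eq_smul_one]; rfl
  map_star' a := by
    have h := θ₂.proj_of_even (map_one θ₂.auto)
    rw [star_tmul, h.1, h.2, star_one, star_zero, tmul_zero, add_zero]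

/-- The embedding `b ↦ 1 Ⓕ b`. -/
def inr (θ₁ : Grading A₁) (θ₂ : Grading A₂) : A₂ →⋆ₐ[ℂ] FermiTensor θ₁ θ₂ where
  toFun b := tmul θ₁ θ₂ 1 b
  map_one' := rfl
  map_zero' := TensorProduct.tmul_zero _ _
  map_add' a b := TensorProduct.tmul_add 1 a b
  map_mul' a b := by
    rw [tmul_mul_tmul, map_one, mul_one, ← tmul_add, ← add_mul, θ₂.proj_add_proj]
  commutes' r := by
    rw [Algebra.algebraMap_eq_smul_one, Algebra.algebraMap_eq_smul_one]
    exact TensorProduct.tmul_smul r (1 : A₁) (1 : A₂)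
  map_star' b := by
    rw [star_tmul, map_one, star_one, ← tmul_add, ← star_add, θ₂.proj_add_proj]

theorem inl_mul_inr (a : A₁) (b : A₂) : inl θ₁ θ₂ a * inr θ₁ θ₂ b = tmul θ₁ θ₂ a b := by
  have h := θ₂.proj_of_even (map_one θ₂.auto)
  change tmul θ₁ θ₂ a 1 * tmul θ₁ θ₂ 1 b = _
  rw [tmul_mul_tmul, h.1, h.2, one_mul, zero_mul, tmul_zero, add_zero, mul_one]

theorem leftBounded (φ : PositiveFunctional (FermiTensor θ₁ θ₂)) (x : FermiTensor θ₁ θ₂) :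
    φ.LeftBounded x := by
  induction x using FermiTensor.induction_on with
  | zero => exact ⟨0, fun y => by simp⟩
  | tmul a b =>
    rw [← inl_mul_inr]
    exact (PositiveFunctional.leftBounded_of_starAlgHom _ a).mul
      (PositiveFunctional.leftBounded_of_starAlgHom _ b)
  | add x y hx hy => exact hx.add hy

end FermiTensor

/-- An even state of a `ℤ₂`-graded `C*`-algebra: a positive unital functional that is invariant
under the grading. -/
structure EvenState {A : Type*} [CStarAlgebra A] (θ : Grading A) extends PositiveFunctional A where
  map_one' : toFun 1 = 1
  even' : ∀ a, toFun (θ.auto a) = toFun a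

namespace FermiTensor

variable {θ₁ : Grading A₁} {θ₂ : Grading A₂}

/-- The product functional `a Ⓕ b ↦ ω₁ a * ω₂ b`. -/
def productFunctional (ω₁ : EvenState θ₁) (ω₂ : EvenState θ₂) : FermiTensor θ₁ θ₂ →ₗ[ℂ] ℂ :=
  LinearMap.mul' ℂ ℂ ∘ₗ TensorProduct.map ω₁.toLinearMap ω₂.toLinearMap ∘ₗ
    (ofTensor θ₁ θ₂).symm.toLinearMap

theorem productFunctional_tmul (ω₁ : EvenState θ₁) (ω₂ : EvenState θ₂) (a : A₁) (b : A₂) :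
    productFunctional ω₁ ω₂ (tmul θ₁ θ₂ a b) = ω₁.toLinearMap a * ω₂.toLinearMap b := rfl

def toGNS (ω₁ : EvenState θ₁) (ω₂ : EvenState θ₂) :
    FermiTensor θ₁ θ₂ →ₗ[ℂ] ω₁.GNS ⊗[ℂ] ω₂.GNS :=
  TensorProduct.map
    ((Completion.toComplₗᵢ (𝕜 := ℂ)).toLinearMap ∘ₗ ω₁.toPre.toLinearMap)
    ((Completion.toComplₗᵢ (𝕜 := ℂ)).toLinearMap ∘ₗ ω₂.toPre.toLinearMap) ∘ₗ
    (ofTensor θ₁ θ₂).symm.toLinearMap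

theorem inner_toGNS (ω₁ : EvenState θ₁) (ω₂ : EvenState θ₂) (x y : FermiTensor θ₁ θ₂) :
    productFunctional ω₁ ω₂ (star x * y) = ⟪toGNS ω₁ ω₂ x, toGNS ω₁ ω₂ y⟫_ℂ := by
  induction x using FermiTensor.induction_on with
  | zero => rw [star_zero, zero_mul, map_zero, map_zero, inner_zero_left]
  | add x x' hx hx' => rw [star_add, add_mul, map_add, map_add, inner_add_left, hx, hx']
  | tmul a b =>
    induction y using FermiTensor.induction_on with
    | zero => rw [mul_zero, map_zero, map_zero, inner_zero_right]
    | add y y' hy hy' => rw [mul_add, map_add, map_add, inner_add_right, hy, hy']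
    | tmul c d =>
      have e := θ₂.proj_of_even (θ₂.auto_proj_one b)
      have o := θ₂.proj_of_odd (θ₂.auto_proj_neg_one b)
      have hr : ⟪toGNS ω₁ ω₂ (tmul θ₁ θ₂ a b), toGNS ω₁ ω₂ (tmul θ₁ θ₂ c d)⟫_ℂ =
          ω₁.toLinearMap (star a * c) * ω₂.toLinearMap (star b * d) := by
        change ⟪((ω₁.toPre a : ω₁.GNS) ⊗ₜ[ℂ] (ω₂.toPre b : ω₂.GNS)),
          ((ω₁.toPre c : ω₁.GNS) ⊗ₜ[ℂ] (ω₂.toPre d : ω₂.GNS))⟫_ℂ = _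
        rw [TensorProduct.inner_tmul, Completion.inner_coe, Completion.inner_coe]
        rfl
      have hev : ω₁.toLinearMap (star (θ₁.auto a) * θ₁.auto c) =
          ω₁.toLinearMap (star a * c) := by
        rw [← map_star, ← map_mul]; exact ω₁.even' _
      rw [hr, star_tmul, add_mul, tmul_mul_tmul, tmul_mul_tmul]
      simp only [Grading.proj_star, e.1, e.2, o.1, o.2, star_zero, zero_mul, tmul_zero, add_zero,
        zero_add, map_add, productFunctional_tmul, hev]
      rw [← mul_add, ← map_add, ← add_mul, ← star_add, θ₂.proj_add_proj]

/-- The product state `ω₁ × ω₂` of two even states. -/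
def productState (ω₁ : EvenState θ₁) (ω₂ : EvenState θ₂) :
    PositiveFunctional (FermiTensor θ₁ θ₂) where
  toLinearMap := productFunctional ω₁ ω₂
  nonneg' x := by
    change 0 ≤ productFunctional ω₁ ω₂ (star x * x)
    have h := inner_self_eq_norm_sq_to_K (𝕜 := ℂ) (toGNS ω₁ ω₂ x)
    rw [inner_toGNS]
    refine le_of_le_of_eq ?_ h.symm
    positivity

/-- The spatial norm: the supremum of `‖π_{ω₁ × ω₂}(x)‖` over all pairs of even states. -/
def spatialNorm (x : FermiTensor θ₁ θ₂) : ℝ :=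
  ⨆ ω : EvenState θ₁ × EvenState θ₂,
    ‖(productState ω.1 ω.2).gnsRep (leftBounded _) x‖

/-- A `C*`-norm is a cross norm if `β (a Ⓕ b) = ‖a‖ ‖b‖` for homogeneous `a` and `b`. -/
def IsCross (β : CStarNorm (FermiTensor θ₁ θ₂)) : Prop :=
  ∀ a b, θ₁.IsHomogeneous a → θ₂.IsHomogeneous b → β (tmul θ₁ θ₂ a b) = ‖a‖ * ‖b‖

/-- A `C*`-norm is compatible if the grading `θ₁ Ⓕ θ₂` extends to a `*`-automorphism of the
completion. -/
def IsCompatible (β : CStarNorm (FermiTensor θ₁ θ₂)) : Prop :=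
  ∃ Θ : β.Completion ≃⋆ₐ[ℂ] β.Completion,
    ∀ x, Θ (β.toCompletion x) = β.toCompletion (grading θ₁ θ₂ x)

end FermiTensor

end Fermi

end

noncomputable section

/-! ### Characters of commutative `C*`-algebras -/

section Characters

variable {C : Type*} [CStarAlgebra C]

/-! Write `C` for the commutative factor, `A` for the other one and `B` for the completion under
`β`. The even part of `C` commutes with both factors, so its image is central in the image of the
algebraic tensor product. This centrality reduces both inequalities to states of `B` that are
multiplicative on even elements of `C`.

The main device is `GradedPair.exists_product_state`: a state `φ` of `B` that is multiplicative on
the even part of `C` satisfies `φ ≤ 4 P` for some product `P` of even states. Averaging `φ` over the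
grading removes the terms of mixed parity, but not the odd-odd ones. These are cancelled by a second
state `y ↦ φ(b* y b) / φ(b* b)` with `b ∈ C` odd: moving `b*` past `A` applies the grading of `A`,
hence flips the sign on odd-odd products. If no odd `b` has `φ(b* b) ≠ 0`, Cauchy–Schwarz already
makes the odd-odd terms vanish.

Spatial norm at least `β` (`CStarNorm.exists_le_norm_gnsRep`): for `x` in the algebraic tensor
product, `h = x* x` and the even part of `C` generate a commutative algebra. Some character of it
attains `‖h‖`; extend it to a state `φ` and take the dominating `P`. Then `‖h‖^(2n) ≤ 4 P(h^(2n)) ≤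
4 ‖π_P(x)‖^(4n)` for all `n`, and taking roots removes the 4.

Spatial norm at most `β` (`CStarNorm.norm_gnsRep_le`): it suffices that every product of even states
is `β`-contractive. By slicing, the state of `C` is replaced by a character `τ`. Contractivity of `ω
⊗ τ` on the even parts follows from the cross property by localising near `τ` with an even bump
element (`exists_even_bump`). A Hahn–Banach extension and `exists_product_state` then pass from the
even parts to the whole algebra. -/

theorem exists_character_norm_eq [Nontrivial C] (hC : ∀ a b : C, a * b = b * a) (y : C) :
    ∃ τ : C →⋆ₐ[ℂ] ℂ, ‖τ y‖ = ‖y‖ := by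
  let _ : CommCStarAlgebra C := { ‹CStarAlgebra C› with mul_comm := hC }
  have : IsStarNormal y := ⟨mul_comm _ _⟩
  obtain ⟨z, hz, hzy⟩ := spectrum.exists_nnnorm_eq_spectralRadius (A := C) y
  rw [IsStarNormal.spectralRadius_eq_nnnorm] at hzy
  obtain ⟨τ, hτ⟩ := WeakDual.CharacterSpace.mem_spectrum_iff_exists.1 hz
  refine ⟨{ (WeakDual.CharacterSpace.toAlgHom τ : C →ₐ[ℂ] ℂ) with
    map_star' := fun a => map_star τ a }, ?_⟩
  have h : ‖z‖₊ = ‖y‖₊ := by exact_mod_cast hzy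
  rw [← coe_nnnorm y, ← h, ← hτ]
  rfl

theorem norm_le_of_forall_character (hC : ∀ a b : C, a * b = b * a) {y : C} {M : ℝ} (hM : 0 ≤ M)
    (h : ∀ τ : C →⋆ₐ[ℂ] ℂ, ‖τ y‖ ≤ M) : ‖y‖ ≤ M := by
  rcases subsingleton_or_nontrivial C with hs | hn
  · rw [Subsingleton.elim y 0, norm_zero]; exact hM
  · obtain ⟨τ, hτ⟩ := exists_character_norm_eq hC y
    exact hτ ▸ h τ

theorem isUnit_of_forall_character_ne_zero (hC : ∀ a b : C, a * b = b * a) {y : C}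
    (h : ∀ τ : C →⋆ₐ[ℂ] ℂ, τ y ≠ 0) : IsUnit y := by
  let _ : CommCStarAlgebra C := { ‹CStarAlgebra C› with mul_comm := hC }
  by_contra hy
  obtain ⟨τ, hτ⟩ := WeakDual.CharacterSpace.exists_apply_eq_zero hy
  exact h { (WeakDual.CharacterSpace.toAlgHom τ : C →ₐ[ℂ] ℂ) with
    map_star' := fun a => map_star τ a } hτ

end Characters

/-! ### Positive functionals on `C*`-algebras -/

namespace PositiveFunctional

section Algebraic

variable {F : Type*} [Ring F] [StarRing F] [Algebra ℂ F] [StarModule ℂ F]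
  (φ : PositiveFunctional F)

theorem norm_apply_star_mul_sq_le (x y : F) :
    ‖φ.toLinearMap (star x * y)‖ ^ 2 ≤
      (φ.toLinearMap (star x * x)).re * (φ.toLinearMap (star y * y)).re := by
  rw [← φ.inner_toPre x y, ← φ.norm_toPre_sq x, ← φ.norm_toPre_sq y, ← mul_pow]
  exact pow_le_pow_left₀ (norm_nonneg _) (norm_inner_le_norm _ _) 2

/-- Cauchy–Schwarz: the left kernel of a positive functional is annihilated under left
multiplication. -/
theorem apply_mul_eq_zero (x : F) {y : F} (hy : φ.toLinearMap (star y * y) = 0) :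
    φ.toLinearMap (x * y) = 0 := by
  have h := φ.norm_apply_star_mul_sq_le (star x) y
  rw [star_star, hy, Complex.zero_re, mul_zero] at h
  exact norm_eq_zero.1 (pow_eq_zero_iff two_ne_zero |>.1 (le_antisymm h (sq_nonneg _)))

/-- The functional is the vector state of the unit cyclic vector, the class of `1`. -/
theorem norm_apply_le_norm_gnsRep (hφ : ∀ x, φ.LeftBounded x) (h1 : φ.toLinearMap 1 = 1) (x : F) :
    ‖φ.toLinearMap x‖ ≤ ‖φ.gnsRep hφ x‖ := by
  have hn : ‖(φ.toPre 1 : φ.GNS)‖ = 1 := by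
    rw [Completion.norm_coe, ← sq_eq_sq₀ (norm_nonneg _) zero_le_one, norm_toPre_sq, star_one,
      one_mul, h1, Complex.one_re, one_pow]
  have hx : ⟪(φ.toPre 1 : φ.GNS), φ.gnsRep hφ x (φ.toPre 1 : φ.GNS)⟫_ℂ = φ.toLinearMap x := by
    have : φ.gnsRep hφ x (φ.toPre 1 : φ.GNS) = (φ.toPre (x * 1) : φ.GNS) :=
      ContinuousLinearMap.completion_apply_coe _ _
    rw [this, Completion.inner_coe, inner_toPre, star_one, one_mul, mul_one]
  rw [← hx]
  refine (norm_inner_le_norm _ _).trans ?_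
  rw [hn, one_mul]
  simpa [hn] using (φ.gnsRep hφ x).le_opNorm (φ.toPre 1 : φ.GNS)

theorem norm_gnsRep_star_mul_self (hφ : ∀ x, φ.LeftBounded x) (x : F) :
    ‖φ.gnsRep hφ (star x * x)‖ = ‖φ.gnsRep hφ x‖ ^ 2 := by
  rw [map_mul, map_star, sq]
  exact ContinuousLinearMap.norm_adjoint_comp_self _

theorem norm_gnsRep_le (hφ : ∀ x, φ.LeftBounded x) {x : F} {M : ℝ} (hM : 0 ≤ M)
    (h : ∀ y, ‖φ.toPre (x * y)‖ ≤ M * ‖φ.toPre y‖) : ‖φ.gnsRep hφ x‖ ≤ M := by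
  refine ContinuousLinearMap.opNorm_le_bound _ hM fun z => ?_
  induction z using Completion.induction_on with
  | hp => exact isClosed_le (by fun_prop) (by fun_prop)
  | ih z =>
    have : φ.gnsRep hφ x (z : φ.GNS) = (φ.toPre (x * φ.toPre.symm z) : φ.GNS) :=
      ContinuousLinearMap.completion_apply_coe _ _
    rw [this, Completion.norm_coe, Completion.norm_coe]
    exact h (φ.toPre.symm z)

end Algebraic

section CStar

variable {B : Type*} [CStarAlgebra B] (φ : PositiveFunctional B)

theorem norm_toPre_mul_le (x y : B) : ‖φ.toPre (x * y)‖ ≤ ‖x‖ * ‖φ.toPre y‖ := by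
  have hφ : ∀ x, φ.LeftBounded x := leftBounded_of_starAlgHom (StarAlgHom.id ℂ B)
  have h1 : φ.gnsRep hφ x (φ.toPre y : φ.GNS) = (φ.toPre (x * y) : φ.GNS) :=
    ContinuousLinearMap.completion_apply_coe _ _
  rw [← Completion.norm_coe (φ.toPre y), ← Completion.norm_coe (φ.toPre (x * y)), ← h1]
  exact ((φ.gnsRep hφ x).le_opNorm _).trans
    (mul_le_mul_of_nonneg_right (NonUnitalStarAlgHom.norm_apply_le (φ.gnsRep hφ) x)
      (norm_nonneg _))

theorem norm_apply_le (h1 : φ.toLinearMap 1 = 1) (x : B) : ‖φ.toLinearMap x‖ ≤ ‖x‖ :=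
  (φ.norm_apply_le_norm_gnsRep (leftBounded_of_starAlgHom (StarAlgHom.id ℂ B)) h1 x).trans
    (NonUnitalStarAlgHom.norm_apply_le (φ.gnsRep _) x)

/-- A unital functional of norm at most one on a `C*`-algebra is positive. -/
theorem nonneg_of_norm_le (f : B →ₗ[ℂ] ℂ) (hf : ∀ x, ‖f x‖ ≤ ‖x‖) (h1 : f 1 = 1) (x : B) :
    0 ≤ f (star x * x) := by
  have : Nontrivial B := by
    refine nontrivial_of_ne (1 : B) 0 fun h => ?_
    rw [h, map_zero] at h1
    exact zero_ne_one h1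
  set a := star x * x with ha
  have hsa : IsSelfAdjoint a := IsSelfAdjoint.star_mul_self x
  have him : (f a).im = 0 := by
    -- Compare `|f(a + it)|² ≤ ‖a + it‖² ≤ ‖a‖² + t²` with the expansion of the left side: the `t²`
    -- cancel, and what remains is linear in `t`, which forces its coefficient to vanish.
    have key : ∀ t : ℝ, 2 * (t * (f a).im) ≤ ‖a‖ ^ 2 := fun t => by
      have h := hf (a + (t * Complex.I) • 1)
      have h2 : ‖a + ((t : ℂ) * Complex.I) • (1 : B)‖ ^ 2 ≤ ‖a‖ ^ 2 + t ^ 2 := by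
        rw [sq ‖a + _‖, ← CStarRing.norm_star_mul_self]
        have : star (a + ((t : ℂ) * Complex.I) • (1 : B)) * (a + ((t : ℂ) * Complex.I) • 1) =
            a * a + ((t ^ 2 : ℝ) : ℂ) • 1 := by
          simp only [star_add, star_smul, star_one, hsa.star_eq, add_mul, mul_add, mul_one,
            one_mul, smul_mul_assoc, mul_smul_comm, star_mul', Complex.star_def,
            Complex.conj_I, Complex.conj_ofReal]
          have : (t : ℂ) * Complex.I * (t * -Complex.I) = ((t ^ 2 : ℝ) : ℂ) := by
            push_cast; linear_combination (-(t : ℂ) ^ 2) * Complex.I_sq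
          rw [smul_add, smul_smul, this]
          module
        rw [this]
        refine (norm_add_le _ _).trans (add_le_add ?_ ?_)
        · rw [sq]; exact norm_mul_le _ _
        · rw [norm_smul, norm_one, mul_one, Complex.norm_real, Real.norm_eq_abs, abs_sq]
      have h3 : ‖f (a + ((t : ℂ) * Complex.I) • 1)‖ ^ 2 ≤ ‖a‖ ^ 2 + t ^ 2 :=
        (pow_le_pow_left₀ (norm_nonneg _) h 2).trans h2
      rw [map_add, map_smul, h1, smul_eq_mul, mul_one, ← Complex.normSq_eq_norm_sq,
        Complex.normSq_apply] at h3
      simp only [Complex.add_re, Complex.mul_re, Complex.ofReal_re, Complex.I_re, mul_zero,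
        Complex.ofReal_im, Complex.I_im, mul_one, sub_self, add_zero, Complex.add_im,
        Complex.mul_im] at h3
      nlinarith [mul_self_nonneg (f a).re, mul_self_nonneg (f a).im]
    by_contra hne
    have h := key ((‖a‖ ^ 2 + 1) / (f a).im)
    rw [div_mul_cancel₀ _ hne] at h
    nlinarith [sq_nonneg ‖a‖]
  refine Complex.nonneg_iff.2 ⟨?_, him.symm⟩
  let _ := CStarAlgebra.spectralOrder B
  let _ := CStarAlgebra.spectralOrderedRing B
  have hpos : 0 ≤ a := star_mul_self_nonneg x
  -- Since `0 ≤ a ≤ ‖a‖`, the element `‖a‖ - a` has norm at most `‖a‖`; applying `f` gives `‖a‖ - Re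
  -- f(a) ≤ ‖a‖`.
  have hn : ‖algebraMap ℝ B ‖a‖ - a‖ ≤ ‖a‖ := by
    have h : 0 ≤ algebraMap ℝ B ‖a‖ - a := sub_nonneg.2 hsa.le_algebraMap_norm_self
    rw [CStarAlgebra.norm_le_iff_le_algebraMap _ (norm_nonneg _) h]
    exact sub_le_self _ hpos
  have h := (Complex.re_le_norm _).trans ((hf _).trans hn)
  rw [map_sub, IsScalarTower.algebraMap_apply ℝ ℂ B, Algebra.algebraMap_eq_smul_one, map_smul,
    h1] at h
  simp at h
  exact h

/-- Extension of states along a linear map into a `C*`-algebra. -/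
theorem exists_state_extension {V : Type*} [AddCommGroup V] [Module ℂ V] (T : V →ₗ[ℂ] B)
    (Q : V →ₗ[ℂ] ℂ) (hQ : ∀ v, ‖Q v‖ ≤ ‖T v‖) {v₀ : V} (hT₀ : T v₀ = 1) (hQ₀ : Q v₀ = 1) :
    ∃ φ : PositiveFunctional B, φ.toLinearMap 1 = 1 ∧ ∀ v, φ.toLinearMap (T v) = Q v := by
  -- The bound lets `Q` descend to a contractive functional on the range of `T`. Its Hahn–Banach
  -- extension is contractive and unital, hence positive.
  have hker : LinearMap.ker T ≤ LinearMap.ker Q := fun v hv => by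
    rw [LinearMap.mem_ker] at hv ⊢
    simpa [hv] using hQ v
  let f : LinearMap.range T →ₗ[ℂ] ℂ :=
    (LinearMap.ker T).liftQ Q hker ∘ₗ T.quotKerEquivRange.symm.toLinearMap
  have hf : ∀ v, f (T.rangeRestrict v) = Q v := fun v => by
    have : T.quotKerEquivRange.symm (T.rangeRestrict v) = (LinearMap.ker T).mkQ v := by
      rw [LinearEquiv.symm_apply_eq]; rfl
    change (LinearMap.ker T).liftQ Q hker (T.quotKerEquivRange.symm (T.rangeRestrict v)) = _
    rw [this]; rfl
  have hfn : ∀ w, ‖f w‖ ≤ 1 * ‖w‖ := fun w => by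
    obtain ⟨v, rfl⟩ := T.surjective_rangeRestrict w
    rw [hf, one_mul]
    exact hQ v
  obtain ⟨g, hg, hgn⟩ := exists_extension_norm_eq _ (f.mkContinuous 1 hfn)
  have hgn' : ‖g‖ ≤ 1 := hgn ▸ LinearMap.mkContinuous_norm_le _ zero_le_one _
  have hgT : ∀ v, g (T v) = Q v := fun v => (hg (T.rangeRestrict v)).trans (hf v)
  have hg1 : g 1 = 1 := by rw [← hT₀, hgT, hQ₀]
  exact ⟨⟨g.toLinearMap, nonneg_of_norm_le g.toLinearMap
    (fun x => (g.le_of_opNorm_le hgn' x).trans_eq (one_mul _)) hg1⟩, hg1, hgT⟩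

end CStar

end PositiveFunctional

/-! ### Graded pairs of `C*`-algebras inside a `C*`-algebra -/

/-- Two `ℤ₂`-graded `C*`-algebras mapped into a `C*`-algebra such that their images commute in the
graded sense, the gradings being induced by an automorphism. -/
structure GradedPair {A C : Type*} [CStarAlgebra A] [CStarAlgebra C] (θA : Grading A)
    (θC : Grading C) (B : Type*) [CStarAlgebra B] where
  left : A →⋆ₐ[ℂ] B
  right : C →⋆ₐ[ℂ] B
  auto : B ≃⋆ₐ[ℂ] B
  auto_left : ∀ a, auto (left a) = left (θA.auto a)
  auto_right : ∀ c, auto (right c) = right (θC.auto c)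
  even_comm : ∀ a c, θC.auto c = c → right c * left a = left a * right c
  odd_comm : ∀ a c, θC.auto c = -c → right c * left a = left (θA.auto a) * right c

/-- The average of the states `φ`, `φ ∘ Θ`, `κ` and `κ ∘ Θ` dominates a quarter of `φ`. -/
theorem PositiveFunctional.exists_average {B : Type*} [CStarAlgebra B]
    (φ κ : PositiveFunctional B) (Θ : B ≃⋆ₐ[ℂ] B) (hφ : φ.toLinearMap 1 = 1)
    (hκ : κ.toLinearMap 1 = 1) :
    ∃ P : PositiveFunctional B, P.toLinearMap 1 = 1 ∧
      (∀ y, P.toLinearMap y = 4⁻¹ * (φ.toLinearMap y + φ.toLinearMap (Θ y) +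
        (κ.toLinearMap y + κ.toLinearMap (Θ y)))) ∧
      ∀ z, (φ.toLinearMap (star z * z)).re ≤ 4 * (P.toLinearMap (star z * z)).re := by
  let L : B →ₗ[ℂ] B := Θ.toAlgEquiv.toLinearMap
  let p : B →ₗ[ℂ] ℂ := (4⁻¹ : ℂ) • (φ.toLinearMap + φ.toLinearMap ∘ₗ L +
    (κ.toLinearMap + κ.toLinearMap ∘ₗ L))
  have hp : ∀ y, p y = 4⁻¹ * (φ.toLinearMap y + φ.toLinearMap (Θ y) +
        (κ.toLinearMap y + κ.toLinearMap (Θ y))) := fun y => rfl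
  have hΘ : ∀ ψ : PositiveFunctional B, ∀ z, 0 ≤ ψ.toLinearMap (Θ (star z * z)) := fun ψ z => by
    rw [map_mul, map_star]; exact ψ.nonneg _
  have h4 : ((4⁻¹ : ℝ) : ℂ) = 4⁻¹ := by norm_num
  refine ⟨⟨p, fun z => ?_⟩, ?_, hp, fun z => ?_⟩
  · change 0 ≤ p (star z * z)
    rw [hp, ← h4]
    have h1 := φ.nonneg z
    have h2 := κ.nonneg z
    exact mul_nonneg (Complex.zero_le_real.2 (by norm_num))
      (add_nonneg (add_nonneg h1 (hΘ φ z)) (add_nonneg h2 (hΘ κ z)))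
  · change p 1 = 1
    rw [hp, map_one Θ, hφ, hκ]
    norm_num
  · change _ ≤ 4 * (p (star z * z)).re
    rw [hp, ← h4, Complex.re_ofReal_mul]
    have h1 := (Complex.nonneg_iff.1 (κ.nonneg z)).1
    have h2 := (Complex.nonneg_iff.1 (hΘ φ z)).1
    have h3 := (Complex.nonneg_iff.1 (hΘ κ z)).1
    simp only [Complex.add_re]
    linarith

namespace GradedPair

variable {A C B : Type*} [CStarAlgebra A] [CStarAlgebra C] [CStarAlgebra B] {θA : Grading A}
  {θC : Grading C} (g : GradedPair θA θC B)

/-- The multiplicative domain argument: the hypothesis says that `c - φ(c)` lies in the left kernel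
of `φ`. -/
theorem apply_mul_right (φ : PositiveFunctional B) (hφ : φ.toLinearMap 1 = 1) {c : C}
    (hc : φ.toLinearMap (g.right (star c * c)) =
      star (φ.toLinearMap (g.right c)) * φ.toLinearMap (g.right c)) (y : B) :
    φ.toLinearMap (y * g.right c) = φ.toLinearMap y * φ.toLinearMap (g.right c) := by
  set r := φ.toLinearMap (g.right c) with hr
  have h := φ.apply_mul_eq_zero y (y := g.right c - r • 1) (by
    rw [map_mul, map_star] at hc
    simp only [star_sub, star_smul, star_one, sub_mul, mul_sub, mul_smul_comm, smul_mul_assoc,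
      mul_one, one_mul, map_sub, map_smul, hc, φ.apply_star, ← hr, smul_eq_mul, hφ]
    ring)
  rw [mul_sub, mul_smul_comm, mul_one, map_sub, map_smul, smul_eq_mul, sub_eq_zero] at h
  rw [h, mul_comm]

/-- A state that is multiplicative on the even part of the commutative factor is dominated by four
times a product state. -/
theorem exists_product_state (hC : ∀ a b : C, a * b = b * a) (φ : PositiveFunctional B)
    (hφ : φ.toLinearMap 1 = 1)
    (hmul : ∀ c, θC.auto c = c → φ.toLinearMap (g.right (star c * c)) =
      star (φ.toLinearMap (g.right c)) * φ.toLinearMap (g.right c)) :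
    ∃ P : PositiveFunctional B, P.toLinearMap 1 = 1 ∧
      (∀ a d, P.toLinearMap (g.left a * g.right d) =
        φ.toLinearMap (g.left (θA.proj 1 a)) * φ.toLinearMap (g.right (θC.proj 1 d))) ∧
      ∀ z, (φ.toLinearMap (star z * z)).re ≤ 4 * (P.toLinearMap (star z * z)).re := by
  have hmr : ∀ c, θC.auto c = c → ∀ y, φ.toLinearMap (y * g.right c) =
      φ.toLinearMap y * φ.toLinearMap (g.right c) := fun c hc y =>
    g.apply_mul_right φ hφ (hmul c hc) y
  -- `κ` agrees with `φ` on even-even products and is its negative on odd-odd ones.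
  have hκ : ∃ κ : PositiveFunctional B, κ.toLinearMap 1 = 1 ∧
      (∀ a d, θA.auto a = a → θC.auto d = d → κ.toLinearMap (g.left a * g.right d) =
        φ.toLinearMap (g.left a) * φ.toLinearMap (g.right d)) ∧
      (∀ a d, θA.auto a = -a → θC.auto d = -d → φ.toLinearMap (g.left a * g.right d) +
        κ.toLinearMap (g.left a * g.right d) = 0) := by
    by_cases hb : ∀ b, θC.auto b = -b → φ.toLinearMap (g.right (star b * b)) = 0
    · refine ⟨φ, hφ, fun a d _ hd => hmr d hd _, fun a d _ hd => ?_⟩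
      have := hb d hd
      rw [map_mul, map_star] at this
      rw [φ.apply_mul_eq_zero _ this, add_zero]
    · push Not at hb
      obtain ⟨b, hb, hb0⟩ := hb
      have hbb : θC.auto (star b * b) = star b * b := by
        rw [map_mul, map_star, hb, star_neg, neg_mul_neg]
      have hs : θC.auto (star b) = -star b := by rw [map_star, hb, star_neg]
      set r := φ.toLinearMap (g.right (star b * b)) with hr
      have hr0 : 0 ≤ r := by
        rw [hr, map_mul, map_star]; exact φ.nonneg _
      -- The odd element `b*` picks up the grading of `A` when it crosses `a`; the rest is
      -- commutativity of `C`. The factor `b* b` is even, so `φ` splits it off and the normalisation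
      -- by `r` cancels it.
      have hconj : ∀ a d, star (g.right b) * (g.left a * g.right d) * g.right b =
          g.left (θA.auto a) * g.right d * g.right (star b * b) := fun a d => by
        rw [← map_star, ← mul_assoc, g.odd_comm _ _ hs]
        simp only [mul_assoc, ← map_mul]
        rw [hC (star b) (d * b), hC (star b) b, mul_assoc]
      have hr1 : 0 ≤ r⁻¹ := by
        obtain ⟨hre, him⟩ := Complex.nonneg_iff.1 hr0
        rw [Complex.ext (Complex.ofReal_re r.re).symm him.symm, ← Complex.ofReal_inv]
        exact Complex.zero_le_real.2 (inv_nonneg.2 hre)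
      let k : B →ₗ[ℂ] ℂ := r⁻¹ • (φ.toLinearMap ∘ₗ LinearMap.mulLeft ℂ (star (g.right b)) ∘ₗ
          LinearMap.mulRight ℂ (g.right b))
      have hk : ∀ y, k y = r⁻¹ * φ.toLinearMap (star (g.right b) * (y * g.right b)) :=
        fun y => rfl
      have hkk : ∀ a d, k (g.left a * g.right d) =
          φ.toLinearMap (g.left (θA.auto a) * g.right d) := fun a d => by
        rw [hk, ← mul_assoc (star (g.right b)), hconj, hmr _ hbb, ← hr, mul_comm,
          mul_assoc, mul_inv_cancel₀ hb0, mul_one]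
      refine ⟨⟨k, fun z => ?_⟩, ?_, fun a d ha hd => ?_, fun a d ha hd => ?_⟩
      · change 0 ≤ k (star z * z)
        rw [hk]
        refine mul_nonneg hr1 ?_
        have := φ.nonneg (z * g.right b)
        rwa [star_mul, mul_assoc, ← mul_assoc (star z)] at this
      · change k 1 = 1
        rw [hk, one_mul, ← map_star, ← map_mul, ← hr, inv_mul_cancel₀ hb0]
      · exact (hkk a d).trans (by rw [ha, hmr d hd])
      · change _ + k _ = 0
        rw [hkk, ha, map_neg, neg_mul, map_neg, add_neg_cancel]
  obtain ⟨κ, hκ1, hκe, hκo⟩ := hκ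
  obtain ⟨P, hP1, hP, hle⟩ := φ.exists_average κ g.auto hφ hκ1
  refine ⟨P, hP1, fun a d => ?_, hle⟩
  have ha := θA.auto_proj_one a
  have ha' := θA.auto_proj_neg_one a
  have hd := θC.auto_proj_one d
  have hd' := θC.auto_proj_neg_one d
  have e1 : P.toLinearMap (g.left (θA.proj 1 a) * g.right (θC.proj 1 d)) =
      φ.toLinearMap (g.left (θA.proj 1 a)) * φ.toLinearMap (g.right (θC.proj 1 d)) := by
    rw [hP, map_mul g.auto, g.auto_left, g.auto_right, ha, hd, hκe _ _ ha hd, hmr _ hd]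
    ring
  -- Mixed parities die because `P` averages over the grading automorphism; the odd-odd term `e4`
  -- survives that average and needs `κ`.
  have e2 : P.toLinearMap (g.left (θA.proj 1 a) * g.right (θC.proj (-1) d)) = 0 := by
    rw [hP, map_mul g.auto, g.auto_left, g.auto_right, ha, hd', map_neg, mul_neg, map_neg, map_neg]
    ring
  have e3 : P.toLinearMap (g.left (θA.proj (-1) a) * g.right (θC.proj 1 d)) = 0 := by
    rw [hP, map_mul g.auto, g.auto_left, g.auto_right, ha', hd, map_neg, neg_mul, map_neg, map_neg]
    ring
  have e4 : P.toLinearMap (g.left (θA.proj (-1) a) * g.right (θC.proj (-1) d)) = 0 := by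
    rw [hP, map_mul g.auto, g.auto_left, g.auto_right, ha', hd', map_neg, map_neg, neg_mul_neg]
    linear_combination 2⁻¹ * hκo _ _ ha' hd'
  conv_lhs => rw [← θA.proj_add_proj a, ← θC.proj_add_proj d]
  simp only [map_add, add_mul, mul_add, e1, e2, e3, e4, add_zero]

end GradedPair

/-! ### Even bump elements at a character -/

/-- Take `e = (1 + δ⁻² ∑ u_k* u_k)⁻¹`. It is even because the `u_k` are, equals 1 at `τ` because
they vanish there, and `t ≤ δ (1 + t²/δ²)` bounds `|u_k| e` by `δ` at every character. -/
theorem exists_even_bump {C : Type*} [CStarAlgebra C] (hC : ∀ a b : C, a * b = b * a)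
    (θ : Grading C) (τ : C →⋆ₐ[ℂ] ℂ) {ι : Type*} (s : Finset ι) (u : ι → C)
    (hu : ∀ k ∈ s, θ.auto (u k) = u k) (hτ : ∀ k ∈ s, τ (u k) = 0) {δ : ℝ} (hδ : 0 < δ) :
    ∃ e, θ.auto e = e ∧ ‖e‖ ≤ 1 ∧ τ e = 1 ∧ ∀ k ∈ s, ‖u k * e‖ ≤ δ := by
  set m : C := 1 + (((δ ^ 2)⁻¹ : ℝ) : ℂ) • ∑ k ∈ s, star (u k) * u k with hm
  have hσ : ∀ σ : C →⋆ₐ[ℂ] ℂ, σ m = ((1 + (δ ^ 2)⁻¹ * ∑ k ∈ s, ‖σ (u k)‖ ^ 2 : ℝ) : ℂ) :=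
    fun σ => by
      rw [hm, map_add, map_one, map_smul, map_sum]
      push_cast
      congr 1
      rw [smul_eq_mul]
      congr 1
      refine Finset.sum_congr rfl fun k _ => ?_
      rw [map_mul, map_star, Complex.star_def, Complex.conj_mul']
  have hge : ∀ σ : C →⋆ₐ[ℂ] ℂ, 1 ≤ 1 + (δ ^ 2)⁻¹ * ∑ k ∈ s, ‖σ (u k)‖ ^ 2 := fun σ =>
    le_add_of_nonneg_right (by positivity)
  have hunit : IsUnit m := isUnit_of_forall_character_ne_zero hC fun σ => by
    rw [hσ]
    exact_mod_cast (zero_lt_one.trans_le (hge σ)).ne'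
  obtain ⟨e, hme⟩ := hunit.exists_right_inv
  have hem : e * m = 1 := by rw [hC, hme]
  have hσe : ∀ σ : C →⋆ₐ[ℂ] ℂ, σ m * σ e = 1 := fun σ => by rw [← map_mul, hme, map_one]
  have hnorm : ∀ σ : C →⋆ₐ[ℂ] ℂ,
      (1 + (δ ^ 2)⁻¹ * ∑ k ∈ s, ‖σ (u k)‖ ^ 2) * ‖σ e‖ = 1 := fun σ => by
    have h := congrArg norm (hσe σ)
    rw [norm_mul, hσ, Complex.norm_real, Real.norm_of_nonneg (zero_le_one.trans (hge σ)),
      norm_one] at h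
    exact h
  have hθm : θ.auto m = m := by
    rw [hm, map_add, map_one, θ.auto_smul, map_sum]
    congr 2
    refine Finset.sum_congr rfl fun k hk => ?_
    rw [map_mul, map_star, hu k hk]
  refine ⟨e, ?_, ?_, ?_, fun k hk => ?_⟩
  · have h : m * θ.auto e = 1 := by
      conv_lhs => rw [← hθm]
      rw [← map_mul, hme, map_one]
    calc θ.auto e = e * m * θ.auto e := by rw [hem, one_mul]
      _ = e := by rw [mul_assoc, h, mul_one]
  · refine norm_le_of_forall_character hC zero_le_one fun σ => ?_
    nlinarith [hnorm σ, hge σ, norm_nonneg (σ e)]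
  · have h := hσe τ
    rw [hσ, Finset.sum_eq_zero fun k hk => by rw [hτ k hk]; simp] at h
    simpa using h
  · refine norm_le_of_forall_character hC hδ.le fun σ => ?_
    rw [map_mul, norm_mul]
    have h1 : ‖σ (u k)‖ ^ 2 ≤ ∑ k ∈ s, ‖σ (u k)‖ ^ 2 :=
      Finset.single_le_sum (f := fun k => ‖σ (u k)‖ ^ 2) (fun _ _ => sq_nonneg _) hk
    have h2 : ‖σ (u k)‖ ≤ δ * (1 + (δ ^ 2)⁻¹ * ∑ k ∈ s, ‖σ (u k)‖ ^ 2) := by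
      have h3 : ‖σ (u k)‖ ≤ δ * (1 + (δ ^ 2)⁻¹ * ‖σ (u k)‖ ^ 2) := by
        have : δ * (1 + (δ ^ 2)⁻¹ * ‖σ (u k)‖ ^ 2) - ‖σ (u k)‖ =
            ((δ - ‖σ (u k)‖) ^ 2 + δ * ‖σ (u k)‖) / δ := by
          field_simp
          ring
        have h4 : 0 ≤ ((δ - ‖σ (u k)‖) ^ 2 + δ * ‖σ (u k)‖) / δ := by positivity
        linarith
      refine h3.trans ?_
      gcongr
    calc ‖σ (u k)‖ * ‖σ e‖
        ≤ δ * (1 + (δ ^ 2)⁻¹ * ∑ k ∈ s, ‖σ (u k)‖ ^ 2) * ‖σ e‖ := by gcongr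
      _ = δ := by rw [mul_assoc, hnorm, mul_one]

/-! ### Even states obtained by projecting onto the even part -/

namespace EvenState

variable {A : Type*} [CStarAlgebra A] {θ : Grading A} (ω : EvenState θ)

theorem apply_one : ω.toLinearMap 1 = 1 := ω.map_one'

theorem apply_proj_one (a : A) : ω.toLinearMap (θ.proj 1 a) = ω.toLinearMap a := by
  have h : ω.toLinearMap (θ.auto a) = ω.toLinearMap a := ω.even' a
  rw [θ.proj_apply, map_smul, map_add, map_smul, h, Units.val_one, Int.cast_one, one_smul,
    smul_eq_mul]
  ring

/-- The even state `a ↦ φ (f (E a))`, where `E` is the projection onto the even part. -/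
def ofState {B : Type*} [CStarAlgebra B] (φ : PositiveFunctional B) (hφ : φ.toLinearMap 1 = 1)
    (θ : Grading A) (f : A →⋆ₐ[ℂ] B) : EvenState θ where
  toLinearMap := φ.toLinearMap ∘ₗ f.toAlgHom.toLinearMap ∘ₗ θ.proj 1
  nonneg' a := by
    change 0 ≤ φ.toLinearMap (f (θ.proj 1 (star a * a)))
    rw [θ.proj_apply, map_smul, map_smul, map_add, map_smul, Units.val_one, Int.cast_one, one_smul,
      map_add, map_mul θ.auto, map_star θ.auto, map_mul f, map_mul f, map_star f, map_star f,
      smul_eq_mul,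
      show (2⁻¹ : ℂ) = ((2⁻¹ : ℝ) : ℂ) by norm_num]
    exact mul_nonneg (Complex.zero_le_real.2 (by norm_num))
      (add_nonneg (φ.nonneg _) (φ.nonneg _))
  map_one' := by
    change φ.toLinearMap (f (θ.proj 1 1)) = 1
    rw [(θ.proj_of_even (map_one _)).1, map_one, hφ]
  even' a := by
    change φ.toLinearMap (f (θ.proj 1 (θ.auto a))) = φ.toLinearMap (f (θ.proj 1 a))
    rw [θ.proj_apply, θ.involutive, Units.val_one, Int.cast_one, one_smul, add_comm,
      θ.proj_apply, Units.val_one, Int.cast_one, one_smul]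

end EvenState

/-! ### Contractivity of product states and states detecting the norm -/

namespace GradedPair

variable {A C B : Type*} [CStarAlgebra A] [CStarAlgebra C] [CStarAlgebra B] {θA : Grading A}
  {θC : Grading C} (g : GradedPair θA θC B)

/-- The norm is multiplicative on products of even elements of the two factors. -/
def IsEvenCross : Prop :=
  ∀ a c, θA.auto a = a → θC.auto c = c → ‖g.left a * g.right c‖ = ‖a‖ * ‖c‖

variable {g}

/-- Multiply `∑ a_k c_k` by a bump `e` at `τ`: up to a small error each `c_k` becomes the scalar
`τ(c_k)`, and the cross property evaluates the norm of `(∑ τ(c_k) a_k) e`. -/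
theorem IsEvenCross.norm_sum_smul_le (hg : g.IsEvenCross) (hC : ∀ a b : C, a * b = b * a)
    (τ : C →⋆ₐ[ℂ] ℂ) {ι : Type*} (s : Finset ι) (a : ι → A) (c : ι → C)
    (ha : ∀ k ∈ s, θA.auto (a k) = a k) (hc : ∀ k ∈ s, θC.auto (c k) = c k) :
    ‖∑ k ∈ s, τ (c k) • a k‖ ≤ ‖∑ k ∈ s, g.left (a k) * g.right (c k)‖ := by
  refine le_of_forall_pos_le_add fun ε hε => ?_
  set K := ∑ k ∈ s, ‖a k‖ with hK
  have hK0 : 0 ≤ K := Finset.sum_nonneg fun _ _ => norm_nonneg _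
  -- With `δ = ε / (K + 1)` the total error is at most `K δ ≤ ε`; the `+ 1` covers `K = 0`.
  obtain ⟨e, hθe, hne, hτe, hue⟩ := exists_even_bump hC θC τ s (fun k => c k - τ (c k) • 1)
    (fun k hk => by rw [map_sub, θC.auto_smul, map_one, hc k hk])
    (fun k _ => by rw [map_sub, map_smul, map_one, smul_eq_mul, mul_one, sub_self])
    (δ := ε / (K + 1)) (by positivity)
  have hne1 : 1 ≤ ‖e‖ := by
    have := NonUnitalStarAlgHom.norm_apply_le τ e
    rwa [hτe, norm_one] at this
  have hsum : θA.auto (∑ k ∈ s, τ (c k) • a k) = ∑ k ∈ s, τ (c k) • a k := by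
    rw [map_sum]
    exact Finset.sum_congr rfl fun k hk => by rw [θA.auto_smul, ha k hk]
  have heq : g.left (∑ k ∈ s, τ (c k) • a k) * g.right e =
      (∑ k ∈ s, g.left (a k) * g.right (c k)) * g.right e -
        ∑ k ∈ s, g.left (a k) * g.right ((c k - τ (c k) • 1) * e) := by
    rw [map_sum, Finset.sum_mul, Finset.sum_mul, ← Finset.sum_sub_distrib]
    refine Finset.sum_congr rfl fun k _ => ?_
    rw [map_smul, map_mul, map_sub, map_smul, map_one, sub_mul, mul_sub, smul_mul_assoc,
      smul_mul_assoc, one_mul, mul_smul_comm, mul_assoc, sub_sub_cancel]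
  have h1 := hg _ e hsum hθe
  have h2 : ‖g.right e‖ ≤ 1 := (NonUnitalStarAlgHom.norm_apply_le g.right e).trans hne
  calc ‖∑ k ∈ s, τ (c k) • a k‖ ≤ ‖∑ k ∈ s, τ (c k) • a k‖ * ‖e‖ :=
        le_mul_of_one_le_right (norm_nonneg _) hne1
    _ = _ := h1.symm
    _ ≤ ‖∑ k ∈ s, g.left (a k) * g.right (c k)‖ * 1 + K * (ε / (K + 1)) := by
      rw [heq]
      refine (norm_sub_le _ _).trans (add_le_add ((norm_mul_le _ _).trans (by gcongr)) ?_)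
      rw [hK, Finset.sum_mul]
      refine (norm_sum_le _ _).trans (Finset.sum_le_sum fun k hk => (norm_mul_le _ _).trans ?_)
      exact mul_le_mul (NonUnitalStarAlgHom.norm_apply_le g.left _)
        ((NonUnitalStarAlgHom.norm_apply_le g.right _).trans (hue k hk)) (norm_nonneg _)
        (norm_nonneg _)
    _ ≤ _ := by
      rw [mul_one]
      gcongr
      rw [mul_div_assoc', div_le_iff₀ (by positivity)]
      nlinarith

/-- By the slice estimate, `ω ⊗ τ` is contractive on the span of even-even products, so it extends
to a state of `B`. Composing with the even projections defines it on the whole tensor product. -/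
theorem IsEvenCross.exists_state (hg : g.IsEvenCross) (hC : ∀ a b : C, a * b = b * a)
    (ω : PositiveFunctional A) (hω : ω.toLinearMap 1 = 1) (τ : C →⋆ₐ[ℂ] ℂ) :
    ∃ φ : PositiveFunctional B, φ.toLinearMap 1 = 1 ∧ ∀ a c, θA.auto a = a → θC.auto c = c →
      φ.toLinearMap (g.left a * g.right c) = ω.toLinearMap a * τ c := by
  let T : A ⊗[ℂ] C →ₗ[ℂ] B := TensorProduct.lift ((LinearMap.mul ℂ B).compl₁₂
    (g.left.toAlgHom.toLinearMap ∘ₗ θA.proj 1) (g.right.toAlgHom.toLinearMap ∘ₗ θC.proj 1))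
  let Q : A ⊗[ℂ] C →ₗ[ℂ] ℂ := TensorProduct.lift ((LinearMap.mul ℂ ℂ).compl₁₂
    (ω.toLinearMap ∘ₗ θA.proj 1) (τ.toAlgHom.toLinearMap ∘ₗ θC.proj 1))
  have hT : ∀ a c, T (a ⊗ₜ c) = g.left (θA.proj 1 a) * g.right (θC.proj 1 c) := fun a c => rfl
  have hQ : ∀ a c, Q (a ⊗ₜ c) = ω.toLinearMap (θA.proj 1 a) * τ (θC.proj 1 c) := fun a c => rfl
  have e1 := (θA.proj_of_even (map_one _)).1
  have e2 := (θC.proj_of_even (map_one _)).1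
  obtain ⟨φ, hφ1, hφ⟩ := PositiveFunctional.exists_state_extension T Q (v₀ := 1 ⊗ₜ 1) (fun v => by
    obtain ⟨s, rfl⟩ := TensorProduct.exists_finset v
    have h := hg.norm_sum_smul_le hC τ s (fun p => θA.proj 1 p.1) (fun p => θC.proj 1 p.2)
      (fun p _ => θA.auto_proj_one _) (fun p _ => θC.auto_proj_one _)
    simp only [map_sum, hT, hQ]
    refine le_trans ?_ ((ω.norm_apply_le hω _).trans h)
    simp only [map_sum, map_smul, smul_eq_mul, mul_comm]
    rfl) (by rw [hT, e1, e2, map_one, map_one, mul_one]) (by rw [hQ, e1, e2, hω, map_one, mul_one])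
  refine ⟨φ, hφ1, fun a c ha hc => ?_⟩
  have h := hφ (a ⊗ₜ c)
  rwa [hT, hQ, (θA.proj_of_even ha).1, (θC.proj_of_even hc).1] at h

/-- Slicing by `ωA` leaves an even element `f` of `C`. A character `τ` attaining `‖f‖` replaces
`ωC`, and the product state built from `ωA` and `τ` takes the value `τ(f)` on the given sum. -/
theorem IsEvenCross.norm_sum_apply_le (hg : g.IsEvenCross) (hC : ∀ a b : C, a * b = b * a)
    (ωA : EvenState θA) (ωC : EvenState θC) {ι : Type*} (s : Finset ι) (a : ι → A) (c : ι → C) :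
    ‖∑ k ∈ s, ωA.toLinearMap (a k) * ωC.toLinearMap (c k)‖ ≤
      ‖∑ k ∈ s, g.left (a k) * g.right (c k)‖ := by
  have : Nontrivial C := by
    refine nontrivial_of_ne (1 : C) 0 fun h => ?_
    have h1 := ωC.apply_one
    rw [h, map_zero] at h1
    exact zero_ne_one h1
  -- Projecting `c k` costs nothing, as `ωC` is even, and matches `P`, which sees only even parts.
  set f := ∑ k ∈ s, ωA.toLinearMap (a k) • θC.proj 1 (c k) with hf
  have h1 : ∑ k ∈ s, ωA.toLinearMap (a k) * ωC.toLinearMap (c k) = ωC.toLinearMap f := by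
    simp only [hf, map_sum, map_smul, ωC.apply_proj_one, smul_eq_mul]
  obtain ⟨τ, hτ⟩ := exists_character_norm_eq hC f
  obtain ⟨φ, hφ1, hφ⟩ := hg.exists_state hC ωA.toPositiveFunctional ωA.apply_one τ
  have hright : ∀ d, θC.auto d = d → φ.toLinearMap (g.right d) = τ d := fun d hd => by
    have h := hφ 1 d (map_one _) hd
    rwa [map_one, one_mul, ωA.apply_one, one_mul] at h
  have hleft : ∀ d, θA.auto d = d → φ.toLinearMap (g.left d) = ωA.toLinearMap d := fun d hd => by
    have h := hφ d 1 hd (map_one _)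
    rwa [map_one, mul_one, map_one, mul_one] at h
  obtain ⟨P, hP1, hP, -⟩ := g.exists_product_state hC φ hφ1 fun d hd => by
    rw [hright _ hd, hright _ (by rw [map_mul, map_star, hd]), map_mul, map_star]
  have h2 : P.toLinearMap (∑ k ∈ s, g.left (a k) * g.right (c k)) = τ f := by
    simp only [hf, map_sum, map_smul, hP, hleft _ (θA.auto_proj_one _),
      hright _ (θC.auto_proj_one _), ωA.apply_proj_one, smul_eq_mul]
  rw [h1]
  refine (ωC.norm_apply_le ωC.apply_one f).trans ?_
  rw [← hτ, ← h2]
  exact P.norm_apply_le hP1 _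

variable (g)

/-- Extend to `B` a norm-attaining character of a commutative `C*`-algebra containing `h` and the
even part of `C`. -/
theorem exists_multiplicative_state [Nontrivial B] (hC : ∀ a b : C, a * b = b * a) (h : B)
    (hsa : IsSelfAdjoint h)
    (hh : ∀ c, θC.auto c = c → g.right c * h = h * g.right c) :
    ∃ φ : PositiveFunctional B, φ.toLinearMap 1 = 1 ∧
      (∀ c, θC.auto c = c → φ.toLinearMap (g.right (star c * c)) =
        star (φ.toLinearMap (g.right c)) * φ.toLinearMap (g.right c)) ∧
      ∀ n : ℕ, ‖φ.toLinearMap (h ^ n)‖ = ‖h‖ ^ n := by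
  set S : Set B := insert h (Set.image g.right {c | θC.auto c = c})
  have hstar : S ∪ star S = S := by
    refine Set.union_eq_left.2 fun x hx => ?_
    rcases Set.mem_star.1 hx with hx | ⟨c, hc, hx⟩
    · exact Or.inl (by rw [← star_star x, hx, hsa.star_eq])
    · refine Or.inr ⟨star c, ?_, by rw [map_star, hx, star_star]⟩
      change θC.auto (star c) = star c
      rw [map_star, show θC.auto c = c from hc]
  have hcomm : ∀ x ∈ S, ∀ y ∈ S, x * y = y * x := by
    rintro x (rfl | ⟨c, hc, rfl⟩) y (rfl | ⟨d, hd, rfl⟩)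
    · rfl
    · exact (hh d hd).symm
    · exact hh c hc
    · rw [← map_mul, hC, map_mul]
  -- The bicommutant of a commuting self-adjoint set is commutative and norm closed, so it serves as
  -- this algebra.
  let D := StarSubalgebra.centralizer ℂ (StarSubalgebra.centralizer ℂ S : Set B)
  have hD : (D : Set B) = S.centralizer.centralizer := by
    rw [StarSubalgebra.coe_centralizer_centralizer, hstar]
  have : IsClosed (D : Set B) := hD ▸ Set.isClosed_centralizer _
  have hSD : ∀ x ∈ S, x ∈ D := fun x hx => by
    rw [← SetLike.mem_coe, hD]; exact Set.subset_centralizer_centralizer hx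
  have hDc : ∀ x y : D, x * y = y * x := fun x y => Subtype.ext
    (Set.centralizer_centralizer_comm_of_comm hcomm _ (hD ▸ x.2) _ (hD ▸ y.2))
  obtain ⟨τ, hτ⟩ := exists_character_norm_eq hDc ⟨h, hSD h (Or.inl rfl)⟩
  obtain ⟨φ, hφ1, hφ⟩ := PositiveFunctional.exists_state_extension
    D.subtype.toAlgHom.toLinearMap τ.toAlgHom.toLinearMap (v₀ := 1)
    (fun v => NonUnitalStarAlgHom.norm_apply_le τ v) rfl (map_one τ)
  have hφ' : ∀ x : D, φ.toLinearMap (x : B) = τ x := hφ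
  refine ⟨φ, hφ1, fun c hc => ?_, fun n => ?_⟩
  · let d : D := ⟨g.right c, hSD _ (Or.inr ⟨c, hc, rfl⟩)⟩
    have h1 : φ.toLinearMap (g.right c) = τ d := hφ' d
    have h2 : φ.toLinearMap (g.right (star c * c)) = τ (star d * d) := by
      rw [← hφ', map_mul, map_star]; rfl
    rw [h1, h2, map_mul, map_star]
  · have h1 : φ.toLinearMap (h ^ n) = τ (⟨h, hSD h (Or.inl rfl)⟩ ^ n) :=
      hφ' (⟨h, hSD h (Or.inl rfl)⟩ ^ n)
    rw [h1, map_pow, norm_pow, hτ]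
    rfl

/-- The norm of an element commuting with the even part of the commutative factor is detected by a
product of even states. -/
theorem exists_even_states [Nontrivial B] (hC : ∀ a b : C, a * b = b * a) (x : B)
    (hx : ∀ c, θC.auto c = c → g.right c * x = x * g.right c) :
    ∃ (ωA : EvenState θA) (ωC : EvenState θC) (P : PositiveFunctional B),
      (∀ a c, P.toLinearMap (g.left a * g.right c) = ωA.toLinearMap a * ωC.toLinearMap c) ∧
      ∀ n : ℕ, (‖x‖ ^ 2) ^ (n * 2) ≤ 4 * ‖P.toLinearMap ((star x * x) ^ (n * 2))‖ := by
  have hsa : IsSelfAdjoint (star x * x) := IsSelfAdjoint.star_mul_self x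
  obtain ⟨φ, hφ1, hmul, hn⟩ := g.exists_multiplicative_state hC (star x * x) hsa fun c hc => by
    have hc' : θC.auto (star c) = star c := by rw [map_star, hc]
    have h := congrArg star (hx _ hc')
    simp only [star_mul, map_star, star_star] at h
    rw [← mul_assoc, ← h, mul_assoc, hx c hc, mul_assoc]
  obtain ⟨P, hP1, hP, hle⟩ := g.exists_product_state hC φ hφ1 hmul
  refine ⟨EvenState.ofState φ hφ1 θA g.left, EvenState.ofState φ hφ1 θC g.right, P, hP,
    fun n => ?_⟩
  -- Even exponents put the power in the form `z* z`, where the domination `φ ≤ 4 P` applies.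
  have hpow : (star x * x) ^ (n * 2) = star ((star x * x) ^ n) * (star x * x) ^ n := by
    rw [(hsa.pow n).star_eq, ← pow_add, mul_two]
  have h1 := hn (n * 2)
  have h2 := hle ((star x * x) ^ n)
  have h3 := φ.nonneg ((star x * x) ^ n)
  rw [← hpow] at h2 h3
  rw [CStarRing.norm_star_mul_self, ← sq, ← Complex.re_eq_norm.2 h3] at h1
  rw [← h1]
  exact h2.trans (mul_le_mul_of_nonneg_left (Complex.re_le_norm _) (by norm_num))

end GradedPair

/-! ### Comparison of `C*`-norms with product states -/

/-- If `p > q > 0`, the powers of `p / q` would outgrow any constant `K`. -/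
theorem le_of_forall_pow_le_mul_pow {p q K : ℝ} (hq : 0 ≤ q)
    (h : ∀ n : ℕ, p ^ (n * 2) ≤ K * q ^ (n * 2)) : p ≤ q := by
  by_contra! hlt
  rcases hq.eq_or_lt with rfl | hq
  · have := h 1
    rw [zero_pow (by norm_num), mul_zero] at this
    exact absurd this (not_le.2 (by positivity))
  · have h1 : 1 < (p / q) ^ 2 := one_lt_pow₀ ((one_lt_div hq).2 hlt) two_ne_zero
    obtain ⟨n, hn⟩ := pow_unbounded_of_one_lt K h1
    have h2 := h n
    rw [← pow_mul, mul_comm, div_pow, lt_div_iff₀ (by positivity)] at hn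
    exact absurd h2 (not_le.2 hn)

namespace CStarNorm

variable {F : Type*} [Ring F] [StarRing F] [Algebra ℂ F] [StarModule ℂ F] (β : CStarNorm F)

/-- The canonical map of `F` into its completion as a `*`-homomorphism. -/
def completionHom : F →⋆ₐ[ℂ] β.Completion where
  toFun := β.toCompletion
  map_one' := UniformSpace.Completion.coe_one β.Carrier
  map_mul' x y := UniformSpace.Completion.coe_mul (β.toCarrier x) (β.toCarrier y)
  map_zero' := UniformSpace.Completion.coe_zero
  map_add' x y := UniformSpace.Completion.coe_add (β.toCarrier x) (β.toCarrier y)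
  commutes' r := by
    rw [Algebra.algebraMap_eq_smul_one, Algebra.algebraMap_eq_smul_one]
    exact (UniformSpace.Completion.coe_smul r (β.toCarrier 1)).trans
      (congrArg (r • ·) (UniformSpace.Completion.coe_one β.Carrier))
  map_star' x := β.coe_star (β.toCarrier x)

theorem norm_completionHom (x : F) : ‖β.completionHom x‖ = β x :=
  UniformSpace.Completion.norm_coe (β.toCarrier x)

variable {A C : Type*} [CStarAlgebra A] [CStarAlgebra C] {θA : Grading A} {θC : Grading C}
  {l : A →⋆ₐ[ℂ] F} {r : C →⋆ₐ[ℂ] F} {g : GradedPair θA θC β.Completion}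

/-- A functional with product form is continuous for a `C*`-norm that is cross on even elements. -/
theorem norm_gnsRep_le (hC : ∀ a b : C, a * b = b * a) (hgl : ∀ a, g.left a = β.completionHom (l a))
    (hgr : ∀ c, g.right c = β.completionHom (r c)) (hg : g.IsEvenCross)
    (hspan : ∀ x : F, ∃ s : Finset (A × C), ∃ f : A × C → A × C,
      x = ∑ k ∈ s, l (f k).1 * r (f k).2)
    (ωA : EvenState θA) (ωC : EvenState θC) (ψ : PositiveFunctional F)
    (hψ : ∀ a c, ψ.toLinearMap (l a * r c) = ωA.toLinearMap a * ωC.toLinearMap c)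
    (hb : ∀ x, ψ.LeftBounded x) (x : F) : ‖ψ.gnsRep hb x‖ ≤ β x := by
  have hle : ∀ y, ‖ψ.toLinearMap y‖ ≤ ‖β.completionHom y‖ := fun y => by
    obtain ⟨s, f, rfl⟩ := hspan y
    have h := hg.norm_sum_apply_le hC ωA ωC s (fun k => (f k).1) (fun k => (f k).2)
    simpa only [map_sum, hψ, map_mul, hgl, hgr] using h
  have hψ1 : ψ.toLinearMap 1 = 1 := by
    have h := hψ 1 1
    rwa [map_one, map_one, mul_one, ωA.apply_one, ωC.apply_one, mul_one] at h
  obtain ⟨φ, -, hφ⟩ := PositiveFunctional.exists_state_extension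
    β.completionHom.toAlgHom.toLinearMap ψ.toLinearMap (v₀ := 1) hle (map_one β.completionHom) hψ1
  -- The extension `φ` induces the same GNS seminorm, so left multiplication is bounded by the norm
  -- of the completion.
  have hn : ∀ y, ‖ψ.toPre y‖ = ‖φ.toPre (β.completionHom y)‖ := fun y => by
    rw [← sq_eq_sq₀ (norm_nonneg _) (norm_nonneg _), ψ.norm_toPre_sq, φ.norm_toPre_sq, ← hφ,
      ← map_star, ← map_mul]
    rfl
  refine ψ.norm_gnsRep_le hb (apply_nonneg _ _) fun y => ?_
  rw [hn, hn, map_mul, ← norm_completionHom]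
  exact φ.norm_toPre_mul_le _ _

/-- A product functional is determined by its two factors on the span of products, so `ψ` is the
restriction of the state `P` that detects the norm of `x`; comparing powers then absorbs the factor
4. -/
theorem exists_le_norm_gnsRep [Nontrivial β.Completion] (hC : ∀ a b : C, a * b = b * a)
    (hgl : ∀ a, g.left a = β.completionHom (l a)) (hgr : ∀ c, g.right c = β.completionHom (r c))
    (hspan : ∀ x : F, ∃ s : Finset (A × C), ∃ f : A × C → A × C,
      x = ∑ k ∈ s, l (f k).1 * r (f k).2) (x : F) :
    ∃ (ωA : EvenState θA) (ωC : EvenState θC), ∀ ψ : PositiveFunctional F,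
      (∀ a c, ψ.toLinearMap (l a * r c) = ωA.toLinearMap a * ωC.toLinearMap c) →
      ∀ hb : ∀ x, ψ.LeftBounded x, β x ≤ ‖ψ.gnsRep hb x‖ := by
  -- An even element of `C` commutes with `A` by the graded relation and with `C` by commutativity,
  -- hence with `x`.
  obtain ⟨ωA, ωC, P, hP, hn⟩ := g.exists_even_states hC (β.completionHom x) fun c hc => by
    obtain ⟨s, f, rfl⟩ := hspan x
    rw [map_sum, Finset.mul_sum, Finset.sum_mul]
    refine Finset.sum_congr rfl fun k _ => ?_
    rw [map_mul, ← hgl, ← hgr, ← mul_assoc, g.even_comm _ _ hc, mul_assoc, ← map_mul, hC, map_mul,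
      mul_assoc]
  refine ⟨ωA, ωC, fun ψ hψ hb => ?_⟩
  have hPψ : ∀ y, P.toLinearMap (β.completionHom y) = ψ.toLinearMap y := fun y => by
    obtain ⟨s, f, rfl⟩ := hspan y
    simp only [map_sum, hψ, map_mul, ← hgl, ← hgr, hP]
  have hψ1 : ψ.toLinearMap 1 = 1 := by
    have h := hψ 1 1
    rwa [map_one, map_one, mul_one, ωA.apply_one, ωC.apply_one, mul_one] at h
  have hβ : 0 ≤ β x := apply_nonneg _ _
  refine (pow_le_pow_iff_left₀ hβ (norm_nonneg _) two_ne_zero).1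
    (le_of_forall_pow_le_mul_pow (K := 4) (sq_nonneg _) fun n => ?_)
  have h := hn n
  rw [norm_completionHom, ← map_star, ← map_mul, ← map_pow β.completionHom, hPψ] at h
  refine h.trans (mul_le_mul_of_nonneg_left
    ((ψ.norm_apply_le_norm_gnsRep hb hψ1 _).trans ?_) (by norm_num))
  rw [map_pow]
  rcases (n * 2).eq_zero_or_pos with h0 | h0
  · rw [h0, pow_zero, pow_zero]
    exact ContinuousLinearMap.norm_id_le
  · refine (norm_pow_le' _ h0).trans ?_
    rw [ψ.norm_gnsRep_star_mul_self]

end CStarNorm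

/-! ### Application to the Fermi tensor product, with either factor commutative -/

namespace FermiTensor

variable {A₁ A₂ : Type*} [CStarAlgebra A₁] [CStarAlgebra A₂] {θ₁ : Grading A₁} {θ₂ : Grading A₂}

theorem inr_mul_inl (a : A₁) (b : A₂) : inr θ₁ θ₂ b * inl θ₁ θ₂ a =
    tmul θ₁ θ₂ a (θ₂.proj 1 b) + tmul θ₁ θ₂ (θ₁.auto a) (θ₂.proj (-1) b) := by
  change tmul θ₁ θ₂ 1 b * tmul θ₁ θ₂ a 1 = _
  rw [tmul_mul_tmul, one_mul, mul_one, one_mul, mul_one]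

theorem inr_mul_inl_of_even_right (a : A₁) {b : A₂} (hb : θ₂.auto b = b) :
    inr θ₁ θ₂ b * inl θ₁ θ₂ a = inl θ₁ θ₂ a * inr θ₁ θ₂ b := by
  rw [inr_mul_inl, inl_mul_inr, (θ₂.proj_of_even hb).1, (θ₂.proj_of_even hb).2, tmul_zero,
    add_zero]

theorem inr_mul_inl_of_odd_right (a : A₁) {b : A₂} (hb : θ₂.auto b = -b) :
    inr θ₁ θ₂ b * inl θ₁ θ₂ a = inl θ₁ θ₂ (θ₁.auto a) * inr θ₁ θ₂ b := by
  rw [inr_mul_inl, inl_mul_inr, (θ₂.proj_of_odd hb).1, (θ₂.proj_of_odd hb).2, tmul_zero,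
    zero_add]

theorem inl_mul_inr_of_even_left {a : A₁} (ha : θ₁.auto a = a) (b : A₂) :
    inl θ₁ θ₂ a * inr θ₁ θ₂ b = inr θ₁ θ₂ b * inl θ₁ θ₂ a := by
  rw [inr_mul_inl, inl_mul_inr, ha, ← tmul_add, θ₂.proj_add_proj]

theorem inl_mul_inr_of_odd_left {a : A₁} (ha : θ₁.auto a = -a) (b : A₂) :
    inl θ₁ θ₂ a * inr θ₁ θ₂ b = inr θ₁ θ₂ (θ₂.auto b) * inl θ₁ θ₂ a := by
  conv_lhs => rw [← θ₂.proj_add_proj b]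
  rw [← θ₂.proj_sub_proj b, map_add, mul_add, map_sub, sub_mul,
    inr_mul_inl_of_even_right _ (θ₂.auto_proj_one b),
    inr_mul_inl_of_odd_right _ (θ₂.auto_proj_neg_one b), ha, map_neg, neg_mul, sub_neg_eq_add]

theorem grading_tmul (a : A₁) (b : A₂) :
    grading θ₁ θ₂ (tmul θ₁ θ₂ a b) = tmul θ₁ θ₂ (θ₁.auto a) (θ₂.auto b) := rfl

theorem grading_inl (a : A₁) : grading θ₁ θ₂ (inl θ₁ θ₂ a) = inl θ₁ θ₂ (θ₁.auto a) := by
  change grading θ₁ θ₂ (tmul θ₁ θ₂ a 1) = tmul θ₁ θ₂ (θ₁.auto a) 1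
  rw [grading_tmul, map_one]

theorem grading_inr (b : A₂) : grading θ₁ θ₂ (inr θ₁ θ₂ b) = inr θ₁ θ₂ (θ₂.auto b) := by
  change grading θ₁ θ₂ (tmul θ₁ θ₂ 1 b) = tmul θ₁ θ₂ 1 (θ₂.auto b)
  rw [grading_tmul, map_one]

theorem exists_sum_inl_mul_inr (x : FermiTensor θ₁ θ₂) :
    ∃ s : Finset (A₁ × A₂), ∃ f : A₁ × A₂ → A₁ × A₂,
      x = ∑ k ∈ s, inl θ₁ θ₂ (f k).1 * inr θ₁ θ₂ (f k).2 := by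
  obtain ⟨s, hs⟩ := TensorProduct.exists_finset ((ofTensor θ₁ θ₂).symm x)
  refine ⟨s, id, ?_⟩
  simp only [inl_mul_inr]
  exact hs

/-- Needed when the first factor is the commutative one, so that the two factors exchange roles and
products are taken in the opposite order. -/
theorem exists_sum_inr_mul_inl (x : FermiTensor θ₁ θ₂) :
    ∃ s : Finset (A₂ × A₁), ∃ f : A₂ × A₁ → A₂ × A₁,
      x = ∑ k ∈ s, inr θ₁ θ₂ (f k).1 * inl θ₁ θ₂ (f k).2 := by
  let T : A₂ ⊗[ℂ] A₁ →ₗ[ℂ] FermiTensor θ₁ θ₂ :=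
    TensorProduct.lift ((LinearMap.mul ℂ (FermiTensor θ₁ θ₂)).compl₁₂
      (inr θ₁ θ₂).toAlgHom.toLinearMap (inl θ₁ θ₂).toAlgHom.toLinearMap)
  have hT : ∀ b a, T (b ⊗ₜ a) = inr θ₁ θ₂ b * inl θ₁ θ₂ a := fun b a => rfl
  have hx : ∃ v, T v = x := by
    induction x using FermiTensor.induction_on with
    | zero => exact ⟨0, map_zero T⟩
    | add x y hx hy =>
      obtain ⟨v, rfl⟩ := hx
      obtain ⟨w, rfl⟩ := hy
      exact ⟨v + w, map_add T v w⟩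
    | tmul a b =>
      -- The even part of `a` commutes with `b`; moving the odd part to the right turns `b` into `θ₂
      -- b`.
      refine ⟨b ⊗ₜ θ₁.proj 1 a + θ₂.auto b ⊗ₜ θ₁.proj (-1) a, ?_⟩
      rw [map_add, hT, hT, ← inl_mul_inr_of_even_left (θ₁.auto_proj_one a),
        ← inl_mul_inr_of_odd_left (θ₁.auto_proj_neg_one a), ← add_mul, ← map_add,
        θ₁.proj_add_proj, inl_mul_inr]
  obtain ⟨v, rfl⟩ := hx
  obtain ⟨s, rfl⟩ := TensorProduct.exists_finset v
  exact ⟨s, id, by simp only [map_sum, hT, id]⟩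

variable (β : CStarNorm (FermiTensor θ₁ θ₂))

/-- The graded pair `(A₁, A₂)` in the completion of the Fermi tensor product. -/
def leftRightPair (Θ : β.Completion ≃⋆ₐ[ℂ] β.Completion)
    (hΘ : ∀ x, Θ (β.toCompletion x) = β.toCompletion (grading θ₁ θ₂ x)) :
    GradedPair θ₁ θ₂ β.Completion where
  left := β.completionHom.comp (inl θ₁ θ₂)
  right := β.completionHom.comp (inr θ₁ θ₂)
  auto := Θ
  auto_left a := (hΘ _).trans (congrArg β.toCompletion (grading_inl a))
  auto_right b := (hΘ _).trans (congrArg β.toCompletion (grading_inr b))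
  even_comm a b hb := by
    simp only [StarAlgHom.comp_apply, ← map_mul, inr_mul_inl_of_even_right a hb]
  odd_comm a b hb := by
    simp only [StarAlgHom.comp_apply, ← map_mul, inr_mul_inl_of_odd_right a hb]

/-- The graded pair `(A₂, A₁)` in the completion of the Fermi tensor product. -/
def rightLeftPair (Θ : β.Completion ≃⋆ₐ[ℂ] β.Completion)
    (hΘ : ∀ x, Θ (β.toCompletion x) = β.toCompletion (grading θ₁ θ₂ x)) :
    GradedPair θ₂ θ₁ β.Completion where
  left := β.completionHom.comp (inr θ₁ θ₂)
  right := β.completionHom.comp (inl θ₁ θ₂)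
  auto := Θ
  auto_left b := (hΘ _).trans (congrArg β.toCompletion (grading_inr b))
  auto_right a := (hΘ _).trans (congrArg β.toCompletion (grading_inl a))
  even_comm b a ha := by
    simp only [StarAlgHom.comp_apply, ← map_mul, inl_mul_inr_of_even_left ha b]
  odd_comm b a ha := by
    simp only [StarAlgHom.comp_apply, ← map_mul, inl_mul_inr_of_odd_left ha b]

variable {β}

theorem isEvenCross_leftRightPair (hβ : IsCross β) (Θ : β.Completion ≃⋆ₐ[ℂ] β.Completion)
    (hΘ : ∀ x, Θ (β.toCompletion x) = β.toCompletion (grading θ₁ θ₂ x)) :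
    (leftRightPair β Θ hΘ).IsEvenCross := fun a b ha hb => by
  change ‖β.completionHom (inl θ₁ θ₂ a) * β.completionHom (inr θ₁ θ₂ b)‖ = _
  rw [← map_mul, CStarNorm.norm_completionHom, inl_mul_inr, hβ a b (Or.inl ha) (Or.inl hb)]

theorem isEvenCross_rightLeftPair (hβ : IsCross β) (Θ : β.Completion ≃⋆ₐ[ℂ] β.Completion)
    (hΘ : ∀ x, Θ (β.toCompletion x) = β.toCompletion (grading θ₁ θ₂ x)) :
    (rightLeftPair β Θ hΘ).IsEvenCross := fun b a hb ha => by
  change ‖β.completionHom (inr θ₁ θ₂ b) * β.completionHom (inl θ₁ θ₂ a)‖ = _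
  rw [← map_mul, CStarNorm.norm_completionHom, inr_mul_inl_of_even_right a hb, inl_mul_inr,
    hβ a b (Or.inl ha) (Or.inl hb), mul_comm]

theorem productState_inl_mul_inr (ω₁ : EvenState θ₁) (ω₂ : EvenState θ₂) (a : A₁) (b : A₂) :
    (productState ω₁ ω₂).toLinearMap (inl θ₁ θ₂ a * inr θ₁ θ₂ b) =
      ω₁.toLinearMap a * ω₂.toLinearMap b := by
  rw [inl_mul_inr]
  rfl

/-- Reordering only applies `θ₁` to `a` on the odd part of `b`, which the even state `ω₁` does not
notice. -/
theorem productState_inr_mul_inl (ω₁ : EvenState θ₁) (ω₂ : EvenState θ₂) (b : A₂) (a : A₁) :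
    (productState ω₁ ω₂).toLinearMap (inr θ₁ θ₂ b * inl θ₁ θ₂ a) =
      ω₂.toLinearMap b * ω₁.toLinearMap a := by
  have h : ω₁.toLinearMap (θ₁.auto a) = ω₁.toLinearMap a := ω₁.even' a
  rw [inr_mul_inl, ← inl_mul_inr, ← inl_mul_inr, map_add, productState_inl_mul_inr,
    productState_inl_mul_inr, h, ← mul_add, ← map_add, θ₂.proj_add_proj, mul_comm]

theorem eq_spatialNorm_of_bounds (x : FermiTensor θ₁ θ₂)
    (hle : ∀ (ω₁ : EvenState θ₁) (ω₂ : EvenState θ₂),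
      ‖(productState ω₁ ω₂).gnsRep (leftBounded _) x‖ ≤ β x)
    (hge : Nontrivial β.Completion → ∃ (ω₁ : EvenState θ₁) (ω₂ : EvenState θ₂),
      β x ≤ ‖(productState ω₁ ω₂).gnsRep (leftBounded _) x‖) : β x = spatialNorm x := by
  apply le_antisymm
  · rcases subsingleton_or_nontrivial β.Completion with hs | hn
    -- In the zero algebra there may be no states at all; the real supremum is still nonnegative,
    -- and `β x = 0`.
    · rw [← CStarNorm.norm_completionHom, Subsingleton.elim (β.completionHom x) 0, norm_zero]
      exact Real.iSup_nonneg fun _ => norm_nonneg _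
    · obtain ⟨ω₁, ω₂, h⟩ := hge hn
      exact h.trans (le_ciSup (f := fun ω : EvenState θ₁ × EvenState θ₂ =>
        ‖(productState ω.1 ω.2).gnsRep (leftBounded _) x‖)
        ⟨β x, by rintro _ ⟨ω, rfl⟩; exact hle ω.1 ω.2⟩ (ω₁, ω₂))
  · exact Real.iSup_le (fun ω => hle ω.1 ω.2) (apply_nonneg _ _)

theorem eq_spatialNorm_of_comm_left (hC : ∀ a b : A₁, a * b = b * a) (hβ : IsCross β)
    (Θ : β.Completion ≃⋆ₐ[ℂ] β.Completion)
    (hΘ : ∀ x, Θ (β.toCompletion x) = β.toCompletion (grading θ₁ θ₂ x)) (x : FermiTensor θ₁ θ₂) :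
    β x = spatialNorm x := by
  have hl : ∀ a, (rightLeftPair β Θ hΘ).left a = β.completionHom (inr θ₁ θ₂ a) := fun _ => rfl
  have hr : ∀ a, (rightLeftPair β Θ hΘ).right a = β.completionHom (inl θ₁ θ₂ a) := fun _ => rfl
  refine eq_spatialNorm_of_bounds x (fun ω₁ ω₂ => ?_) fun _ => ?_
  · exact β.norm_gnsRep_le hC hl hr (isEvenCross_rightLeftPair hβ Θ hΘ) exists_sum_inr_mul_inl ω₂ ω₁
      (productState ω₁ ω₂) (productState_inr_mul_inl ω₁ ω₂) (leftBounded _) x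
  · obtain ⟨ω₂, ω₁, h⟩ := β.exists_le_norm_gnsRep hC hl hr exists_sum_inr_mul_inl x
    exact ⟨ω₁, ω₂, h (productState ω₁ ω₂) (productState_inr_mul_inl ω₁ ω₂) (leftBounded _)⟩

theorem eq_spatialNorm_of_comm_right (hC : ∀ a b : A₂, a * b = b * a) (hβ : IsCross β)
    (Θ : β.Completion ≃⋆ₐ[ℂ] β.Completion)
    (hΘ : ∀ x, Θ (β.toCompletion x) = β.toCompletion (grading θ₁ θ₂ x)) (x : FermiTensor θ₁ θ₂) :
    β x = spatialNorm x := by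
  have hl : ∀ a, (leftRightPair β Θ hΘ).left a = β.completionHom (inl θ₁ θ₂ a) := fun _ => rfl
  have hr : ∀ a, (leftRightPair β Θ hΘ).right a = β.completionHom (inr θ₁ θ₂ a) := fun _ => rfl
  refine eq_spatialNorm_of_bounds x (fun ω₁ ω₂ => ?_) fun _ => ?_
  · exact β.norm_gnsRep_le hC hl hr (isEvenCross_leftRightPair hβ Θ hΘ) exists_sum_inl_mul_inr ω₁ ω₂
      (productState ω₁ ω₂) (productState_inl_mul_inr ω₁ ω₂) (leftBounded _) x
  · obtain ⟨ω₁, ω₂, h⟩ := β.exists_le_norm_gnsRep hC hl hr exists_sum_inl_mul_inr x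
    exact ⟨ω₁, ω₂, h (productState ω₁ ω₂) (productState_inl_mul_inr ω₁ ω₂) (leftBounded _)⟩

end FermiTensor

end

theorem mainTheorem2 {A₁ A₂ : Type*} [CStarAlgebra A₁] [CStarAlgebra A₂]
    (θ₁ : Grading A₁) (θ₂ : Grading A₂)
    (hcomm : (∀ a b : A₁, a * b = b * a) ∨ (∀ a b : A₂, a * b = b * a))
    (β : CStarNorm (FermiTensor θ₁ θ₂))
    (hcross : FermiTensor.IsCross β) (hcompat : FermiTensor.IsCompatible β)
    (x : FermiTensor θ₁ θ₂) :
    β x = FermiTensor.spatialNorm x := by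
  obtain ⟨Θ, hΘ⟩ := hcompat
  rcases hcomm with hC | hC
  · exact FermiTensor.eq_spatialNorm_of_comm_left hC hcross Θ hΘ x
  · exact FermiTensor.eq_spatialNorm_of_comm_right hC hcross Θ hΘ x
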